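/- Let $p,q\ge 0$, let $M$ be a smooth manifold of dimension $p+q$, and let $E\to M$ be a fake tangent bundle: a smooth real vector bundle isomorphic to $TM$, equipped with a smooth metric $\eta$ of signature $(p,q)$. Write $\mathbb R^{p,q}$ for $\mathbb R^{p+q}$ with its standard metric of signature $(p,q)$, and $FE$ for the principal $O(p,q)$-bundle whose fibre at $x$ is the set of linear isometries $\mathbb R^{p,q}\to E_x$. Let $\mathbf{Poinc}(p,q)$ be the Poincaré 2-group: its group of objects is $O(p,q)$, its group of morphisms is $O(p,q)\ltimes\mathbb R^{p,q}$, the source and target of $(g,h)$ are both $g$, and $(g,h')\circ(g,h)=(g,h'+h)$. The fake 2-frame 2-bundle is the principal $\mathbf{Poinc}(p,q)$ 2-bundle $FE\times_{O(p,q)}\mathbf{Poinc}(p,q)\to M$. A 2-connection $(A,B)$ on the fake 2-frame 2-bundle consists of an open cover $(U_i)$ of $M$ with local trivializations of the 2-bundle over the $U_i$, with transition functions $g_{ij}:U_i\cap U_j\to O(p,q)$, and for each $i$ of a smooth $\mathfrak{o}(p,q)$-valued 1-form $A_i$ and a smooth $\mathbb R^{p,q}$-valued 2-form $B_i$ on $U_i$,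 such that the fake flatness condition $dA_i+A_i\wedge A_i=\underline t(B_i)$ holds (here $\underline t:\mathbb R^{p,q}\to\mathfrak{o}(p,q)$ is the map of the infinitesimal crossed module of $\mathbf{Poinc}(p,q)$, which is zero) and on $U_i\cap U_j$ $$A_i=g_{ij}A_jg_{ij}^{-1}+g_{ij}\,d(g_{ij}^{-1}),\qquad B_i=g_{ij}B_j .$$ It is flat if its curvature $dA_i+A_i\wedge A_i$ and its 2-curvature $dB_i+A_i\wedge B_i$ vanish for all $i$. Let $(A,B)$ be a flat 2-connection on the fake 2-frame 2-bundle. Then $A$ is a flat connection $\omega$ on $E$: there is a smooth, metric-preserving, flat connection $\omega$ on $E$ which is $d+A_i$ in the trivialization of $E$ over $U_i$ induced by that of the 2-bundle, for every $i$. Moreover $B$ is an $E$-valued 2-form on $M$ (given by $B_i$ in these trivializations). Let $d_\omega$ be the covariant exterior derivative on $E$-valued forms and $$H^2_\omega(M,E)=\frac{\ker\big(d_\omega:\Omega^2(M,E)\to\Omega^3(M,E)\big)}{\operatorname{im}\big(d_\omega:\Omega^1(M,E)\to\Omega^2(M,E)\big)} .$$ If $H^2_\omega(M,E)=0$, then $B=d_\omega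 e$ for some smooth $E$-valued 1-form $e$ on $M$. -/

import Mathlib

open Bundle Set
open scoped Manifold ContDiff

noncomputable section

namespace HigherGauge

/-! ### The Lorentz group, the Poincaré group and their Lie algebras -/

/-- The vector space `ℝ^{p,q}`: the first `p` coordinates are the positive directions, the last
`q` ones the negative directions. -/
abbrev Rpq (p q : ℕ) : Type := EuclideanSpace ℝ (Fin p ⊕ Fin q)

/-- The metric `dx₁² + ⋯ + dx_p² - dx_{p+1}² - ⋯ - dx_{p+q}²` of `ℝ^{p,q}`. -/
def minkowski {p q : ℕ} (v w : Rpq p q) : ℝ :=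
  ∑ i : Fin p, v (Sum.inl i) * w (Sum.inl i) - ∑ j : Fin q, v (Sum.inr j) * w (Sum.inr j)

theorem minkowski_add_left {p q : ℕ} (u v w : Rpq p q) :
    minkowski (u + v) w = minkowski u w + minkowski v w := by
  simp only [minkowski, PiLp.add_apply, add_mul, Finset.sum_add_distrib]; ring

theorem minkowski_smul_left {p q : ℕ} (c : ℝ) (v w : Rpq p q) :
    minkowski (c • v) w = c * minkowski v w := by
  simp only [minkowski, PiLp.smul_apply, smul_eq_mul, mul_assoc, ← Finset.mul_sum]; ring

theorem minkowski_comm {p q : ℕ} (v w : Rpq p q) : minkowski v w = minkowski w v := by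
  simp only [minkowski, mul_comm]

theorem minkowski_add_right {p q : ℕ} (u v w : Rpq p q) :
    minkowski u (v + w) = minkowski u v + minkowski u w := by
  rw [minkowski_comm, minkowski_add_left, minkowski_comm v, minkowski_comm w]

theorem minkowski_smul_right {p q : ℕ} (c : ℝ) (v w : Rpq p q) :
    minkowski v (c • w) = c * minkowski v w := by
  rw [minkowski_comm, minkowski_smul_left, minkowski_comm w]

/-- The Lorentz group `O(p,q)`: the linear isometries of `ℝ^{p,q}`. -/
def Lorentz (p q : ℕ) : Subgroup (Rpq p q ≃L[ℝ] Rpq p q) where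
  carrier := {g | ∀ v w, minkowski (g v) (g w) = minkowski v w}
  mul_mem' := fun {a b} ha hb v w => (ha (b v) (b w)).trans (hb v w)
  one_mem' := fun _ _ => rfl
  inv_mem' := fun {a} ha v w => by
    have h := ha (a⁻¹ v) (a⁻¹ w)
    have e : ∀ u, a (a⁻¹ u) = u := fun u => a.apply_symm_apply u
    rw [e, e] at h
    exact h.symm

/-- A Lorentz transformation as an endomorphism of `ℝ^{p,q}`. -/
def toEnd {p q : ℕ} (g : Lorentz p q) : Rpq p q →L[ℝ] Rpq p q :=
  (g : Rpq p q ≃L[ℝ] Rpq p q)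

/-- The Lie algebra `𝔬(p,q)`, as a subspace of the endomorphisms of `ℝ^{p,q}`; its bracket is the
commutator. -/
def lorentzAlgebra (p q : ℕ) : Submodule ℝ (Rpq p q →L[ℝ] Rpq p q) where
  carrier := {X | ∀ v w, minkowski (X v) w + minkowski v (X w) = 0}
  add_mem' := fun {X Y} hX hY v w => by
    have h1 := hX v w
    have h2 := hY v w
    simp only [add_apply, minkowski_add_left, minkowski_add_right]
    linarith
  zero_mem' := fun v w => by simp [minkowski]
  smul_mem' := fun c X hX v w => by
    have h := hX v w
    simp only [smul_apply, minkowski_smul_left, minkowski_smul_right]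
    rw [← mul_add, h, mul_zero]

/-- `𝔬(p,q)` is closed under commutators. -/
theorem commutator_mem {p q : ℕ} {X Y : Rpq p q →L[ℝ] Rpq p q} (hX : X ∈ lorentzAlgebra p q)
    (hY : Y ∈ lorentzAlgebra p q) : X * Y - Y * X ∈ lorentzAlgebra p q := fun v w => by
  have h1 := hX (Y v) w
  have h2 := hY (X v) w
  have h3 := hX v (Y w)
  have h4 := hY v (X w)
  have e : ∀ u, (X * Y - Y * X) u = X (Y u) + (-1 : ℝ) • Y (X u) := fun u => by
    simp [sub_eq_add_neg]
  simp only [e, minkowski_add_left, minkowski_add_right, minkowski_smul_left,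
    minkowski_smul_right]
  linarith

/-- The Poincaré group `IO(p,q) = O(p,q) ⋉ ℝ^{p,q}`. -/
@[ext]
structure Poincare (p q : ℕ) where
  lin : Lorentz p q
  trans : Rpq p q

instance (p q : ℕ) : Group (Poincare p q) :=
  letI : Mul (Poincare p q) := ⟨fun a b => ⟨a.lin * b.lin, a.trans + toEnd a.lin b.trans⟩⟩
  letI : One (Poincare p q) := ⟨⟨1, 0⟩⟩
  letI : Inv (Poincare p q) := ⟨fun a => ⟨a.lin⁻¹, -toEnd a.lin⁻¹ a.trans⟩⟩
  Group.ofLeftAxioms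
    (fun a b c => Poincare.ext (mul_assoc a.lin b.lin c.lin) (by
      change a.trans + toEnd a.lin b.trans + toEnd (a.lin * b.lin) c.trans =
        a.trans + toEnd a.lin (b.trans + toEnd b.lin c.trans)
      rw [map_add, add_assoc]; rfl))
    (fun a => Poincare.ext (one_mul a.lin) (zero_add (toEnd 1 a.trans)))
    (fun a => Poincare.ext (inv_mul_cancel a.lin) (neg_add_cancel _))

theorem Poincare.mul_def {p q : ℕ} (a b : Poincare p q) :
    a * b = ⟨a.lin * b.lin, a.trans + toEnd a.lin b.trans⟩ := rfl

theorem Poincare.one_def {p q : ℕ} : (1 : Poincare p q) = ⟨1, 0⟩ := rfl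

/-! ### Groupoids, strict 2-groups and the Poincaré 2-group -/

/-- A groupoid, presented by its sets of objects and of morphisms; `comp b a` is `b ∘ a`. -/
structure Gpd where
  Obj : Type*
  Mor : Type*
  src : Mor → Obj
  tgt : Mor → Obj
  ident : Obj → Mor
  comp : (b a : Mor) → src b = tgt a → Mor
  src_ident : ∀ x, src (ident x) = x
  tgt_ident : ∀ x, tgt (ident x) = x
  src_comp : ∀ b a h, src (comp b a h) = src a
  tgt_comp : ∀ b a h, tgt (comp b a h) = tgt b
  comp_ident : ∀ a h, comp a (ident (src a)) h = a
  ident_comp : ∀ a h, comp (ident (tgt a)) a h = a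
  assoc : ∀ c b a h h' h'' h''', comp (comp c b h) a h' = comp c (comp b a h'') h'''
  exists_inv : ∀ a, ∃ b h h', comp b a h = ident (src a) ∧ comp a b h' = ident (tgt a)

/-- A strict 2-group: a groupoid whose objects and morphisms form groups, such that all the
structure maps of the groupoid are compatible with multiplication. -/
structure Strict2Group extends Gpd where
  [groupObj : Group Obj]
  [groupMor : Group Mor]
  src_mul : ∀ a b, src (a * b) = src a * src b
  tgt_mul : ∀ a b, tgt (a * b) = tgt a * tgt b
  ident_mul : ∀ x y, ident (x * y) = ident x * ident y
  comp_mul : ∀ b a b' a' h h' h'', comp (b * b') (a * a') h = comp b a h' * comp b' a' h''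

attribute [instance] Strict2Group.groupObj Strict2Group.groupMor

/-- The Poincaré 2-group: `O(p,q)` is its group of objects and `IO(p,q)` its group of morphisms,
the source and the target of `(g,h)` are both `g`, and `(g,h') ∘ (g,h) = (g,h' + h)`. -/
def Poinc (p q : ℕ) : Strict2Group where
  Obj := Lorentz p q
  Mor := Poincare p q
  src := fun m => m.lin
  tgt := fun m => m.lin
  ident := fun g => ⟨g, 0⟩
  comp := fun b a _ => ⟨a.lin, b.trans + a.trans⟩
  src_ident := fun _ => rfl
  tgt_ident := fun _ => rfl
  src_comp := fun _ _ _ => rfl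
  tgt_comp := fun _ _ h => h.symm
  comp_ident := fun a _ => Poincare.ext rfl (add_zero a.trans)
  ident_comp := fun a _ => Poincare.ext rfl (zero_add a.trans)
  assoc := fun c b a _ _ _ _ => Poincare.ext rfl (add_assoc c.trans b.trans a.trans)
  exists_inv := fun a => ⟨⟨a.lin, -a.trans⟩, rfl, rfl,
    Poincare.ext rfl (neg_add_cancel a.trans), Poincare.ext rfl (add_neg_cancel a.trans)⟩
  groupObj := inferInstance
  groupMor := inferInstance
  src_mul := fun _ _ => rfl
  tgt_mul := fun _ _ => rfl
  ident_mul := fun x y => Poincare.ext rfl (by simp [Poincare.mul_def])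
  comp_mul := fun b a b' a' _ h' _ => Poincare.ext rfl (by
    change b.lin = a.lin at h'
    simp only [Poincare.mul_def, map_add, h']
    abel)

/-- In the crossed module of the Poincaré 2-group, `H` is the group of the morphisms `(1,h)`,
which is `ℝ^{p,q}`, and `g` acts on `H` by conjugation with its identity morphism: this is the
obvious action on `ℝ^{p,q}`. -/
theorem Poinc_conj {p q : ℕ} (g : Lorentz p q) (h : Rpq p q) :
    (⟨g, 0⟩ * ⟨1, h⟩ * (⟨g, 0⟩ : Poincare p q)⁻¹ : Poincare p q) = ⟨1, toEnd g h⟩ := by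
  rw [mul_inv_eq_iff_eq_mul]
  simp [Poincare.mul_def]

/-- The map `t : 𝔥 → 𝔤` of the infinitesimal crossed module of the Poincaré 2-group, for
`𝔥 = ℝ^{p,q}` and `𝔤 = 𝔬(p,q)`: the target of every morphism in `H` is `1`, so it is trivial. -/
def tInf (p q : ℕ) : Rpq p q →ₗ[ℝ] lorentzAlgebra p q := 0

/-- The representation of `𝔤` on `𝔥` in the infinitesimal crossed module of the Poincaré 2-group:
the obvious representation of `𝔬(p,q)` on `ℝ^{p,q}`. -/
def alphaInf {p q : ℕ} (X : lorentzAlgebra p q) (h : Rpq p q) : Rpq p q :=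
  (X : Rpq p q →L[ℝ] Rpq p q) h

/-- `O(p,q)`, as a sub-2-group with only identity morphisms, acts on the morphisms of the
Poincaré 2-group by left multiplication. -/
instance (p q : ℕ) : MulAction (Lorentz p q) (Poincare p q) where
  smul g m := ⟨g, 0⟩ * m
  one_smul m := one_mul m
  mul_smul g g' m := by
    change (⟨g * g', 0⟩ : Poincare p q) * m = ⟨g, 0⟩ * (⟨g', 0⟩ * m)
    rw [← mul_assoc]
    congr 1
    simp [Poincare.mul_def]

theorem smul_def {p q : ℕ} (g : Lorentz p q) (m : Poincare p q) : g • m = ⟨g, 0⟩ * m := rfl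

section Bundle

/-! ### Fake tangent bundles and their frames -/

variable (p q : ℕ) {M : Type*} [TopologicalSpace M]
  [ChartedSpace (EuclideanSpace ℝ (Fin (p + q))) M] [IsManifold (𝓡 (p + q)) ∞ M]
  (F : Type*) [NormedAddCommGroup F] [NormedSpace ℝ F]
  (E : M → Type*) [TopologicalSpace (TotalSpace F E)]
  [∀ x, AddCommGroup (E x)] [∀ x, Module ℝ (E x)] [∀ x, TopologicalSpace (E x)]
  [∀ x, IsTopologicalAddGroup (E x)] [∀ x, ContinuousSMul ℝ (E x)]
  [FiberBundle F E] [VectorBundle ℝ F E]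

/-- The data and properties which make a smooth vector bundle `E` on `M` a fake tangent bundle
with a metric of signature `(p,q)`: a smooth metric of this signature, and the existence of a
smooth vector bundle isomorphism `TM ≅ E`. -/
structure FakeTangentBundle where
  metric : ∀ x, E x →L[ℝ] E x →L[ℝ] ℝ
  contMDiff_metric : ContMDiff (𝓡 (p + q)) ((𝓡 (p + q)).prod 𝓘(ℝ, F →L[ℝ] F →L[ℝ] ℝ)) ∞
    (fun x => TotalSpace.mk' (F →L[ℝ] F →L[ℝ] ℝ)
      (E := fun x => E x →L[ℝ] E x →L[ℝ] ℝ) x (metric x))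
  signature : ∀ x, ∃ φ : Rpq p q ≃L[ℝ] E x,
    ∀ v w, metric x (φ v) (φ w) = minkowski v w
  iso_tangent : ∃ L : ∀ x : M, TangentSpace (𝓡 (p + q)) x ≃L[ℝ] E x,
    ContMDiff (𝓡 (p + q))
      ((𝓡 (p + q)).prod 𝓘(ℝ, EuclideanSpace ℝ (Fin (p + q)) →L[ℝ] F)) ∞
      (fun x => TotalSpace.mk' (EuclideanSpace ℝ (Fin (p + q)) →L[ℝ] F)
        (E := fun x => TangentSpace (𝓡 (p + q)) x →L[ℝ] E x) x
        (L x : TangentSpace (𝓡 (p + q)) x →L[ℝ] E x))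

variable {p q F E}

namespace FakeTangentBundle

variable (T : FakeTangentBundle p q F E)

/-- The fibre at `x` of the fake frame bundle: the linear isometries `ℝ^{p,q} → E x`. -/
def FrameAt (x : M) : Type _ :=
  {φ : Rpq p q ≃L[ℝ] E x // ∀ v w, T.metric x (φ v) (φ w) = minkowski v w}

/-- The fake frame bundle. -/
def FrameBundle : Type _ := Σ x : M, T.FrameAt x

/-- The right action of `O(p,q)` on frames, by precomposition. -/
def FrameAt.act {T : FakeTangentBundle p q F E} {x : M} (φ : T.FrameAt x) (g : Lorentz p q) :
    T.FrameAt x :=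
  ⟨(g : Rpq p q ≃L[ℝ] Rpq p q).trans φ.1, fun v w => (φ.2 _ _).trans (g.2 v w)⟩

/-- The right action of `O(p,q)` on the fake frame bundle, turned into a left action with the help
of inverses. -/
instance : MulAction (Lorentz p q) T.FrameBundle where
  smul g φ := ⟨φ.1, φ.2.act g⁻¹⟩
  one_smul _ := rfl
  mul_smul g h φ := by
    change (⟨φ.1, φ.2.act (g * h)⁻¹⟩ : T.FrameBundle) = ⟨φ.1, (φ.2.act h⁻¹).act g⁻¹⟩
    rw [mul_inv_rev]
    rfl

theorem fst_smul (g : Lorentz p q) (φ : T.FrameBundle) : (g • φ).1 = φ.1 := rfl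

theorem smul_left_injective' {φ : T.FrameBundle} {g h : Lorentz p q} (e : g • φ = h • φ) :
    g = h := by
  have e' : φ.2.act g⁻¹ = φ.2.act h⁻¹ := eq_of_heq (Sigma.mk.inj e).2
  have e'' := congrArg Subtype.val e'
  refine inv_injective (Subtype.ext (ContinuousLinearEquiv.ext (funext fun v => ?_)))
  exact φ.2.1.injective (congrArg (fun f : Rpq p q ≃L[ℝ] E φ.1 => f v) e'')

/-! ### The fake 2-frame 2-bundle

Objects and morphisms of the associated 2-bundle are the quotients of `FrameBundle × O(p,q)` and
of `FrameBundle × IO(p,q)` by `(x g, f) ∼ (x, g f)`. These are the orbits of the left action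
`g • (x, f) = (x g⁻¹, g f)`. -/

/-- The objects of the fake 2-frame 2-bundle. -/
def Obj : Type _ := MulAction.orbitRel.Quotient (Lorentz p q) (T.FrameBundle × Lorentz p q)

/-- The morphisms of the fake 2-frame 2-bundle. -/
def Mor : Type _ := MulAction.orbitRel.Quotient (Lorentz p q) (T.FrameBundle × Poincare p q)

variable {T}

/-- The class of `(φ, k)`. -/
def mkObj (φ : T.FrameBundle) (k : Lorentz p q) : T.Obj := Quotient.mk _ (φ, k)

/-- The class of `(φ, m)`. -/
def mkMor (φ : T.FrameBundle) (m : Poincare p q) : T.Mor := Quotient.mk _ (φ, m)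

theorem mkObj_eq {φ ψ : T.FrameBundle} {k l : Lorentz p q} :
    mkObj φ k = mkObj ψ l ↔ ∃ g : Lorentz p q, g • ψ = φ ∧ g * l = k := by
  refine Quotient.eq.trans ⟨?_, ?_⟩
  · rintro ⟨g, hg⟩
    exact ⟨g, congrArg Prod.fst hg, congrArg Prod.snd hg⟩
  · rintro ⟨g, h1, h2⟩
    exact ⟨g, Prod.ext h1 h2⟩

theorem mkMor_eq {φ ψ : T.FrameBundle} {k l : Poincare p q} :
    mkMor φ k = mkMor ψ l ↔ ∃ g : Lorentz p q, g • ψ = φ ∧ g • l = k := by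
  refine Quotient.eq.trans ⟨?_, ?_⟩
  · rintro ⟨g, hg⟩
    exact ⟨g, congrArg Prod.fst hg, congrArg Prod.snd hg⟩
  · rintro ⟨g, h1, h2⟩
    exact ⟨g, Prod.ext h1 h2⟩

theorem mkMor_injective {φ : T.FrameBundle} {k l : Poincare p q} (h : mkMor φ k = mkMor φ l) :
    k = l := by
  obtain ⟨g, h1, h2⟩ := mkMor_eq.1 h
  have : g = 1 := T.smul_left_injective' (h1.trans (one_smul _ φ).symm)
  rw [← h2, this, one_smul]

/-- The projection of an object to `M`. -/
def projObj (z : T.Obj) : M :=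
  Quotient.liftOn z (fun a => a.1.1) (by rintro _ _ ⟨g, rfl⟩; rfl)

/-- The projection of a morphism to `M`. -/
def projMor (z : T.Mor) : M :=
  Quotient.liftOn z (fun a => a.1.1) (by rintro _ _ ⟨g, rfl⟩; rfl)

/-- The source of `[φ, m]` is `[φ, src m]`. -/
def src (z : T.Mor) : T.Obj :=
  Quotient.liftOn z (fun a => mkObj a.1 ((Poinc p q).src a.2)) (by
    rintro _ b ⟨g, rfl⟩; exact mkObj_eq.2 ⟨g, rfl, rfl⟩)

/-- The target of `[φ, m]` is `[φ, tgt m]`. -/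
def tgt (z : T.Mor) : T.Obj :=
  Quotient.liftOn z (fun a => mkObj a.1 ((Poinc p q).tgt a.2)) (by
    rintro _ b ⟨g, rfl⟩; exact mkObj_eq.2 ⟨g, rfl, rfl⟩)

/-- The identity morphism of `[φ, k]` is `[φ, ident k]`. -/
def ident (z : T.Obj) : T.Mor :=
  Quotient.liftOn z (fun a => mkMor a.1 ((Poinc p q).ident a.2)) (by
    rintro _ b ⟨g, rfl⟩; exact mkMor_eq.2 ⟨g, rfl, ((Poinc p q).ident_mul g b.2).symm⟩)

/-- The right action of objects of the Poincaré 2-group: `[φ, k] g = [φ, k g]`. -/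
def actObj (z : T.Obj) (g : Lorentz p q) : T.Obj :=
  Quotient.liftOn z (fun a => mkObj a.1 (a.2 * g)) (by
    rintro _ b ⟨h, rfl⟩; exact mkObj_eq.2 ⟨h, rfl, (mul_assoc _ _ _).symm⟩)

/-- The right action of morphisms of the Poincaré 2-group: `[φ, m] n = [φ, m n]`. -/
def actMor (z : T.Mor) (n : Poincare p q) : T.Mor :=
  Quotient.liftOn z (fun a => mkMor a.1 (a.2 * n)) (by
    rintro _ b ⟨h, rfl⟩; exact mkMor_eq.2 ⟨h, rfl, (mul_assoc _ _ _).symm⟩)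

theorem exists_rep (φ : T.FrameBundle) (b : T.Mor) (k : Lorentz p q) (h : src b = mkObj φ k) :
    ∃ n : Poincare p q, (Poinc p q).src n = k ∧ b = mkMor φ n := by
  induction b using Quotient.inductionOn with
  | h b =>
    obtain ⟨g, h1, h2⟩ := mkObj_eq.1 h.symm
    exact ⟨g • b.2, h2, (mkMor_eq.2 ⟨g, h1, rfl⟩).symm⟩

theorem exists_comp (b a : T.Mor) (h : src b = tgt a) :
    ∃ c : T.Mor, ∃ (φ : T.FrameBundle) (n m : Poincare p q)
      (e : (Poinc p q).src n = (Poinc p q).tgt m),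
      b = mkMor φ n ∧ a = mkMor φ m ∧ c = mkMor φ ((Poinc p q).comp n m e) := by
  induction a using Quotient.inductionOn with
  | h a =>
    obtain ⟨n, hn, hb⟩ := exists_rep a.1 b _ h
    exact ⟨_, a.1, n, a.2, hn, hb, rfl, rfl⟩

/-- The composite of `[φ, n]` and `[φ, m]` is `[φ, n ∘ m]`; see `comp_mk`. -/
def comp (b a : T.Mor) (h : src b = tgt a) : T.Mor := (exists_comp b a h).choose

theorem comp_mk (φ : T.FrameBundle) (n m : Poincare p q)
    (h : src (mkMor φ n) = tgt (mkMor φ m)) (e : (Poinc p q).src n = (Poinc p q).tgt m) :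
    comp (mkMor φ n) (mkMor φ m) h = mkMor φ ((Poinc p q).comp n m e) := by
  obtain ⟨ψ, n', m', e', h1, h2, h3⟩ := (exists_comp (mkMor φ n) (mkMor φ m) h).choose_spec
  obtain ⟨g, hg, rfl⟩ := mkMor_eq.1 h1
  obtain ⟨g', hg', rfl⟩ := mkMor_eq.1 h2
  obtain rfl : g = g' := T.smul_left_injective' (hg.trans hg'.symm)
  refine Eq.trans h3 (mkMor_eq.2 ⟨g⁻¹, by rw [← hg, inv_smul_smul], ?_⟩)
  refine inv_smul_eq_iff.2 (Poincare.ext rfl ?_)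
  change 0 + toEnd g n'.trans + (0 + toEnd g m'.trans) = 0 + toEnd g (n'.trans + m'.trans)
  rw [map_add, zero_add, zero_add, zero_add]

theorem exists_rep_mor (a : T.Mor) : ∃ φ m, a = mkMor (T := T) φ m := by
  induction a using Quotient.inductionOn with
  | h a => exact ⟨a.1, a.2, rfl⟩

theorem eq_of_mkObj_eq {φ : T.FrameBundle} {k l : Lorentz p q} (h : mkObj φ k = mkObj φ l) :
    k = l := by
  obtain ⟨g, h1, h2⟩ := mkObj_eq.1 h
  have : g = 1 := T.smul_left_injective' (h1.trans (one_smul _ φ).symm)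
  rw [← h2, this, one_mul]

variable (T) in
/-- The total groupoid of the fake 2-frame 2-bundle, the associated 2-bundle
`FrameBundle ×_{O(p,q)} Poinc(p,q)`. -/
def twoFrameBundle : Gpd where
  Obj := T.Obj
  Mor := T.Mor
  src := src
  tgt := tgt
  ident := ident
  comp := comp
  src_ident := fun x => Quotient.inductionOn x fun _ => rfl
  tgt_ident := fun x => Quotient.inductionOn x fun _ => rfl
  src_comp := fun b a h => by
    obtain ⟨φ, m, rfl⟩ := exists_rep_mor a
    obtain ⟨n, hn, rfl⟩ := exists_rep φ b _ h
    rw [comp_mk φ n m h hn]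
    rfl
  tgt_comp := fun b a h => by
    obtain ⟨φ, m, rfl⟩ := exists_rep_mor a
    obtain ⟨n, hn, rfl⟩ := exists_rep φ b _ h
    rw [comp_mk φ n m h hn]
    exact congrArg (mkObj φ) hn.symm
  comp_ident := fun a h => by
    obtain ⟨φ, m, rfl⟩ := exists_rep_mor a
    exact (comp_mk φ m ((Poinc p q).ident ((Poinc p q).src m)) h rfl).trans
      (congrArg (mkMor φ) ((Poinc p q).comp_ident m rfl))
  ident_comp := fun a h => by
    obtain ⟨φ, m, rfl⟩ := exists_rep_mor a
    exact (comp_mk φ ((Poinc p q).ident ((Poinc p q).tgt m)) m h rfl).trans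
      (congrArg (mkMor φ) ((Poinc p q).ident_comp m rfl))
  assoc := fun c b a h h' h'' h''' => by
    obtain ⟨φ, m, rfl⟩ := exists_rep_mor a
    obtain ⟨n, hn, rfl⟩ := exists_rep φ b _ h''
    obtain ⟨r, hr, rfl⟩ := exists_rep φ c _ h
    have e1 := comp_mk φ r n h hr
    have e2 := comp_mk φ n m h'' hn
    have k : ∀ {b₁ b₂ a₁ a₂ : T.Mor} (h₁ : src b₁ = tgt a₁) (h₂ : src b₂ = tgt a₂),
        b₁ = b₂ → a₁ = a₂ → comp b₁ a₁ h₁ = comp b₂ a₂ h₂ := by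
      rintro _ _ _ _ _ _ rfl rfl
      rfl
    refine (k h' (show src (mkMor φ ((Poinc p q).comp r n hr)) = tgt (mkMor φ m) from
        congrArg (mkObj φ) hn) e1 rfl).trans (Eq.trans ?_
      (k h''' (show src (mkMor φ r) = tgt (mkMor φ ((Poinc p q).comp n m hn)) from
        congrArg (mkObj φ) (hr.trans hn)) rfl e2).symm)
    refine (comp_mk φ ((Poinc p q).comp r n hr) m _ hn).trans (Eq.trans ?_
      (comp_mk φ r ((Poinc p q).comp n m hn) _ (hr.trans hn)).symm)
    exact congrArg (mkMor φ) ((Poinc p q).assoc r n m hr hn hn (hr.trans hn))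
  exists_inv := fun a => by
    obtain ⟨φ, m, rfl⟩ := exists_rep_mor a
    obtain ⟨n, h, h', e1, e2⟩ := (Poinc p q).exists_inv m
    refine ⟨mkMor φ n, congrArg (mkObj φ) h, congrArg (mkObj φ) h', ?_, ?_⟩
    · exact (comp_mk φ n m _ h).trans (congrArg (mkMor φ) e1)
    · exact (comp_mk φ m n _ h').trans (congrArg (mkMor φ) e2)

variable (T) in
/-- A local trivialization of the fake 2-frame 2-bundle over an open set `base`: an isomorphism
of groupoids over `base`, from the restriction of the 2-bundle to `base` to the product of `base`
with the Poincaré 2-group, which commutes with the right actions of the Poincaré 2-group, and which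
is smooth. It is described by the second components of the maps on objects and on morphisms, whose
values outside `base` are irrelevant.

The local section of the fake frame bundle which goes to `1` under such an isomorphism determines
the inverse isomorphism through `(x, k) ↦ [φ x, k]` on objects and `(x, m) ↦ [φ x, m]` on morphisms,
so smoothness means that this section is smooth as a frame of `E`. -/
structure LocalTrivialization where
  base : Set M
  isOpen_base : IsOpen base
  toObj : T.Obj → Lorentz p q
  toMor : T.Mor → Poincare p q
  bijOn_obj : BijOn (fun z => (projObj z, toObj z)) (projObj ⁻¹' base) (base ×ˢ univ)
  bijOn_mor : BijOn (fun z => (projMor z, toMor z)) (projMor ⁻¹' base) (base ×ˢ univ)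
  map_src : ∀ a, projMor a ∈ base → (Poinc p q).src (toMor a) = toObj (T.twoFrameBundle.src a)
  map_tgt : ∀ a, projMor a ∈ base → (Poinc p q).tgt (toMor a) = toObj (T.twoFrameBundle.tgt a)
  map_ident : ∀ z, projObj z ∈ base → toMor (T.twoFrameBundle.ident z) = (Poinc p q).ident (toObj z)
  map_comp : ∀ b a h h', projMor a ∈ base →
    toMor (T.twoFrameBundle.comp b a h) = (Poinc p q).comp (toMor b) (toMor a) h'
  map_actObj : ∀ z g, projObj z ∈ base → toObj (actObj z g) = toObj z * g
  map_actMor : ∀ a n, projMor a ∈ base → toMor (actMor a n) = toMor a * n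
  smooth : ∀ φ : ∀ x, T.FrameAt x, (∀ x ∈ base, toObj (mkObj ⟨x, φ x⟩ 1) = 1) →
    ∀ v : Rpq p q, ContMDiffOn (𝓡 (p + q)) ((𝓡 (p + q)).prod 𝓘(ℝ, F)) ∞
      (fun x => TotalSpace.mk' F x ((φ x).1 v)) base

variable (T) in
/-- Some frame at `x`. -/
def someFrame (x : M) : T.FrameAt x := ⟨(T.signature x).choose, (T.signature x).choose_spec⟩

namespace LocalTrivialization

/-- The transition function `g_{τσ}` from the trivialization `σ` to the trivialization `τ`;
see `toObj_eq`. -/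
def transition (τ σ : T.LocalTrivialization) (x : M) : Lorentz p q :=
  τ.toObj (mkObj ⟨x, T.someFrame x⟩ 1) * (σ.toObj (mkObj ⟨x, T.someFrame x⟩ 1))⁻¹

theorem exists_eq_mkObj (z : T.Obj) :
    ∀ φ : T.FrameAt (projObj z), ∃ g, z = actObj (mkObj ⟨projObj z, φ⟩ 1) g := by
  induction z using Quotient.inductionOn with
  | h a =>
    obtain ⟨⟨x, ψ⟩, k⟩ := a
    intro (φ : T.FrameAt x)
    let g₀ : Lorentz p q := ⟨ψ.1.trans φ.1.symm, fun v w => by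
      rw [← φ.2, ← ψ.2 v w]
      simp⟩
    refine ⟨g₀ * k, ?_⟩
    change mkObj ⟨x, ψ⟩ k = mkObj ⟨x, φ⟩ (1 * (g₀ * k))
    refine mkObj_eq.2 ⟨g₀⁻¹, ?_, by rw [one_mul, inv_mul_cancel_left]⟩
    change (⟨x, φ.act g₀⁻¹⁻¹⟩ : T.FrameBundle) = ⟨x, ψ⟩
    rw [inv_inv]
    congr 1
    refine Subtype.ext (ContinuousLinearEquiv.ext (funext fun v => ?_))
    exact φ.1.apply_symm_apply (ψ.1 v)

/-- The trivialization `τ` is obtained from the trivialization `σ` by left multiplication with the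
transition function. -/
theorem toObj_eq (τ σ : T.LocalTrivialization) (z : T.Obj) (h : projObj z ∈ τ.base)
    (h' : projObj z ∈ σ.base) :
    τ.toObj z = τ.transition σ (projObj z) * σ.toObj z := by
  obtain ⟨g, hg⟩ := exists_eq_mkObj z (T.someFrame _)
  have h1 : τ.toObj z = τ.toObj (mkObj ⟨projObj z, T.someFrame _⟩ 1) * g := by
    conv_lhs => rw [hg]
    exact τ.map_actObj _ g h
  have h2 : σ.toObj z = σ.toObj (mkObj ⟨projObj z, T.someFrame _⟩ 1) * g := by
    conv_lhs => rw [hg]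
    exact σ.map_actObj _ g h'
  rw [h1, h2, transition]
  group

/-- The trivialization of `E`, as the bundle with fibre `𝔥 = ℝ^{p,q}` associated to the bundle of
objects, which is induced by a local trivialization `τ` of the 2-bundle: it sends `φ v`, for a
frame `φ`, to `τ[φ,1] v`. -/
def coord (τ : T.LocalTrivialization) (x : M) : E x ≃L[ℝ] Rpq p q :=
  (T.someFrame x).1.symm.trans
    (τ.toObj (mkObj ⟨x, T.someFrame x⟩ 1) : Rpq p q ≃L[ℝ] Rpq p q)

end LocalTrivialization

end FakeTangentBundle

/-! ### Differential forms

A form on `M` (or on an open set, with irrelevant values outside) is a family of alternating maps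
on tangent spaces; it is smooth if its values on smooth vector fields are smooth. -/

/-- Smooth vector fields on `M`. -/
abbrev VF (p q : ℕ) (M : Type*) [TopologicalSpace M]
    [ChartedSpace (EuclideanSpace ℝ (Fin (p + q))) M] [IsManifold (𝓡 (p + q)) ∞ M] : Type _ :=
  ContMDiffSection (𝓡 (p + q)) (EuclideanSpace ℝ (Fin (p + q))) ∞
    (TangentSpace (𝓡 (p + q)) : M → Type _)

section Scalar

variable {W : Type*} [NormedAddCommGroup W] [NormedSpace ℝ W]

/-- Smoothness on `U` of a 1-form with values in a fixed vector space. -/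
def SmoothOn1 (A : ∀ x : M, TangentSpace (𝓡 (p + q)) x →L[ℝ] W) (U : Set M) : Prop :=
  ∀ X : VF p q M, ContMDiffOn (𝓡 (p + q)) 𝓘(ℝ, W) ∞ (fun x => A x (X x)) U

/-- Smoothness on `U` of a 2-form with values in a fixed vector space. -/
def SmoothOn2 (B : ∀ x : M, TangentSpace (𝓡 (p + q)) x [⋀^Fin 2]→L[ℝ] W) (U : Set M) : Prop :=
  ∀ X Y : VF p q M, ContMDiffOn (𝓡 (p + q)) 𝓘(ℝ, W) ∞ (fun x => B x ![X x, Y x]) U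

/-- The Lie bracket `[X,Y]` of vector fields, at `x`. -/
def bracket (X Y : VF p q M) (x : M) : TangentSpace (𝓡 (p + q)) x :=
  VectorField.mlieBracket (𝓡 (p + q)) (fun y => X y) (fun y => Y y) x

/-- The exterior derivative of a 1-form, evaluated on vector fields:
`dA(X,Y) = X(A(Y)) - Y(A(X)) - A([X,Y])`. -/
def extDer1 (A : ∀ x : M, TangentSpace (𝓡 (p + q)) x →L[ℝ] W) (X Y : VF p q M) (x : M) : W :=
  mvfderiv (𝓡 (p + q)) (fun y => A y (Y y)) x (X x)
    - mvfderiv (𝓡 (p + q)) (fun y => A y (X y)) x (Y x)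
    - A x (bracket X Y x)

/-- The exterior derivative of a 2-form, evaluated on vector fields. -/
def extDer2 (B : ∀ x : M, TangentSpace (𝓡 (p + q)) x [⋀^Fin 2]→L[ℝ] W) (X Y Z : VF p q M)
    (x : M) : W :=
  mvfderiv (𝓡 (p + q)) (fun y => B y ![Y y, Z y]) x (X x)
    - mvfderiv (𝓡 (p + q)) (fun y => B y ![X y, Z y]) x (Y x)
    + mvfderiv (𝓡 (p + q)) (fun y => B y ![X y, Y y]) x (Z x)
    - B x ![bracket X Y x, Z x]
    + B x ![bracket X Z x, Y x]
    - B x ![bracket Y Z x, X x]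

end Scalar

/-! ### 2-connections on the fake 2-frame 2-bundle -/

open FakeTangentBundle

/-- A (strict) 2-connection on the fake 2-frame 2-bundle: over each patch of an open cover with
local trivializations of the 2-bundle, an `𝔬(p,q)`-valued 1-form `A` and an `ℝ^{p,q}`-valued 2-form
`B` which satisfy fake flatness `dA + A ∧ A = t(B)`, such that on overlaps `(A,B)` transform through
the transition functions: `A_i = g A_j g⁻¹ + g d(g⁻¹)` and `B_i = α(g) B_j`, where `g = g_{ij}`. -/
structure TwoConnection (T : FakeTangentBundle p q F E) (ι : Type*) where
  triv : ι → T.LocalTrivialization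
  covers : ∀ x : M, ∃ i, x ∈ (triv i).base
  A : ι → ∀ x : M, TangentSpace (𝓡 (p + q)) x →L[ℝ] (Rpq p q →L[ℝ] Rpq p q)
  B : ι → ∀ x : M, TangentSpace (𝓡 (p + q)) x [⋀^Fin 2]→L[ℝ] Rpq p q
  A_mem : ∀ i x v, A i x v ∈ lorentzAlgebra p q
  smooth_A : ∀ i, SmoothOn1 (A i) (triv i).base
  smooth_B : ∀ i, SmoothOn2 (B i) (triv i).base
  fake_flat : ∀ i, ∀ X Y : VF p q M, ∀ x ∈ (triv i).base,
    extDer1 (A i) X Y x + (A i x (X x) * A i x (Y x) - A i x (Y x) * A i x (X x)) =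
      (tInf p q (B i x ![X x, Y x])).1
  glue_A : ∀ i j, ∀ x ∈ (triv i).base ∩ (triv j).base, ∀ v : TangentSpace (𝓡 (p + q)) x,
    A i x v =
      toEnd ((triv i).transition (triv j) x) * A j x v * toEnd ((triv i).transition (triv j) x)⁻¹
      + toEnd ((triv i).transition (triv j) x) *
        mvfderiv (𝓡 (p + q)) (fun y => toEnd ((triv i).transition (triv j) y)⁻¹) x v
  glue_B : ∀ i j, ∀ x ∈ (triv i).base ∩ (triv j).base, ∀ v w : TangentSpace (𝓡 (p + q)) x,
    B i x ![v, w] = toEnd ((triv i).transition (triv j) x) (B j x ![v, w])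

namespace TwoConnection

variable {T : FakeTangentBundle p q F E} {ι : Type*} (C : TwoConnection T ι)

/-- The curvature `F = dA + A ∧ A`, where `(A ∧ A)(X,Y) = A(X) A(Y) - A(Y) A(X)`. -/
def curvature (i : ι) (X Y : VF p q M) (x : M) : Rpq p q →L[ℝ] Rpq p q :=
  extDer1 (C.A i) X Y x + (C.A i x (X x) * C.A i x (Y x) - C.A i x (Y x) * C.A i x (X x))

/-- The 2-curvature `G = dB + α(A) ∧ B`. -/
def twoCurvature (i : ι) (X Y Z : VF p q M) (x : M) : Rpq p q :=
  extDer2 (C.B i) X Y Z x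
    + (alphaInf ⟨C.A i x (X x), C.A_mem i x _⟩ (C.B i x ![Y x, Z x])
      - alphaInf ⟨C.A i x (Y x), C.A_mem i x _⟩ (C.B i x ![X x, Z x])
      + alphaInf ⟨C.A i x (Z x), C.A_mem i x _⟩ (C.B i x ![X x, Y x]))

/-- A 2-connection is flat if its curvature and its 2-curvature vanish. -/
def IsFlat : Prop :=
  (∀ i, ∀ X Y : VF p q M, ∀ x ∈ (C.triv i).base, C.curvature i X Y x = 0) ∧
  (∀ i, ∀ X Y Z : VF p q M, ∀ x ∈ (C.triv i).base, C.twoCurvature i X Y Z x = 0)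

/-- `A` is the connection `D` on `E`: in each of the trivializations, `D` is `d + A`. -/
def IsConnection (D : CovariantDerivative (𝓡 (p + q)) F E) : Prop :=
  ∀ i, ∀ x ∈ (C.triv i).base, ∀ s : (∀ y, E y),
    MDifferentiableAt (𝓡 (p + q)) ((𝓡 (p + q)).prod 𝓘(ℝ, F))
      (fun y => TotalSpace.mk' F y (s y)) x →
    ∀ v : TangentSpace (𝓡 (p + q)) x,
      (C.triv i).coord x (D s x v) =
        mvfderiv (𝓡 (p + q)) (fun y => (C.triv i).coord y (s y)) x v
          + C.A i x v ((C.triv i).coord x (s x))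

/-- `B` is the `E`-valued 2-form `β`: it is given by the `B i` in the trivializations. -/
def IsTwoForm (β : ∀ x : M, TangentSpace (𝓡 (p + q)) x [⋀^Fin 2]→L[ℝ] E x) : Prop :=
  ∀ i, ∀ x ∈ (C.triv i).base, ∀ v w : TangentSpace (𝓡 (p + q)) x,
    C.B i x ![v, w] = (C.triv i).coord x (β x ![v, w])

end TwoConnection

/-! ### Connections on `E` and twisted cohomology -/

/-- A connection on `E` which preserves the metric. -/
def IsMetricPreserving (T : FakeTangentBundle p q F E)
    (D : CovariantDerivative (𝓡 (p + q)) F E) : Prop :=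
  ∀ (X : VF p q M) (s t : ContMDiffSection (𝓡 (p + q)) F ∞ E) (x : M),
    mvfderiv (𝓡 (p + q)) (fun y => T.metric y (s y) (t y)) x (X x) =
      T.metric x (D (fun y => s y) x (X x)) (t x) + T.metric x (s x) (D (fun y => t y) x (X x))

/-- A flat connection: `D_X D_Y s - D_Y D_X s - D_{[X,Y]} s = 0`. -/
def IsFlatConnection (D : CovariantDerivative (𝓡 (p + q)) F E) : Prop :=
  ∀ (X Y : VF p q M) (s : ContMDiffSection (𝓡 (p + q)) F ∞ E) (x : M),
    D (fun y => D (fun z => s z) y (Y y)) x (X x)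
      - D (fun y => D (fun z => s z) y (X y)) x (Y x)
      - D (fun z => s z) x (bracket X Y x) = 0

section Cohomology

variable (p q F E)

/-- Smooth `E`-valued 1-forms. -/
def Omega1 : Submodule ℝ (∀ x : M, TangentSpace (𝓡 (p + q)) x →L[ℝ] E x) where
  carrier := {e | ∀ X : VF p q M, ContMDiff (𝓡 (p + q)) ((𝓡 (p + q)).prod 𝓘(ℝ, F)) ∞
    (fun x => TotalSpace.mk' F x (e x (X x)))}
  add_mem' := fun ha hb X => (ha X).add_section (hb X)
  zero_mem' := fun _ => contMDiff_zeroSection ℝ E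
  smul_mem' := fun c _ ha X => (ha X).const_smul_section (a := c)

/-- Smooth `E`-valued 2-forms. -/
def Omega2 : Submodule ℝ (∀ x : M, TangentSpace (𝓡 (p + q)) x [⋀^Fin 2]→L[ℝ] E x) where
  carrier := {b | ∀ X Y : VF p q M, ContMDiff (𝓡 (p + q)) ((𝓡 (p + q)).prod 𝓘(ℝ, F)) ∞
    (fun x => TotalSpace.mk' F x (b x ![X x, Y x]))}
  add_mem' := fun ha hb X Y => (ha X Y).add_section (hb X Y)
  zero_mem' := fun _ _ => contMDiff_zeroSection ℝ E
  smul_mem' := fun c _ ha X Y => (ha X Y).const_smul_section (a := c)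

variable {p q F E}

variable (D : CovariantDerivative (𝓡 (p + q)) F E)

theorem cov_add {s t : ∀ x, E x}
    (hs : ContMDiff (𝓡 (p + q)) ((𝓡 (p + q)).prod 𝓘(ℝ, F)) ∞ (fun x => TotalSpace.mk' F x (s x)))
    (ht : ContMDiff (𝓡 (p + q)) ((𝓡 (p + q)).prod 𝓘(ℝ, F)) ∞ (fun x => TotalSpace.mk' F x (t x)))
    (x : M) : D (fun y => s y + t y) x = D s x + D t x :=
  D.isCovariantDerivativeOnUniv.add ((hs x).mdifferentiableAt (by simp))
    ((ht x).mdifferentiableAt (by simp))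

theorem cov_smul (c : ℝ) {s : ∀ x, E x}
    (hs : ContMDiff (𝓡 (p + q)) ((𝓡 (p + q)).prod 𝓘(ℝ, F)) ∞ (fun x => TotalSpace.mk' F x (s x)))
    (x : M) : D (fun y => c • s y) x = c • D s x :=
  D.isCovariantDerivativeOnUniv.smul_const c ((hs x).mdifferentiableAt (by simp))

/-- The covariant exterior derivative of an `E`-valued 1-form, evaluated on vector fields:
`(d_D e)(X,Y) = D_X(e(Y)) - D_Y(e(X)) - e([X,Y])`. -/
def dOmega1 : Omega1 p q F E →ₗ[ℝ] (VF p q M → VF p q M → ∀ x, E x) where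
  toFun e X Y x := D (fun y => e.1 y (Y y)) x (X x) - D (fun y => e.1 y (X y)) x (Y x)
    - e.1 x (bracket X Y x)
  map_add' e f := by
    funext X Y x
    have h1 := cov_add D (e.2 X) (f.2 X) x
    have h2 := cov_add D (e.2 Y) (f.2 Y) x
    simp only [Submodule.coe_add, Pi.add_apply, add_apply, h1, h2]
    abel
  map_smul' c e := by
    funext X Y x
    have h1 := cov_smul D c (e.2 X) x
    have h2 := cov_smul D c (e.2 Y) x
    simp only [Submodule.coe_smul, Pi.smul_apply, smul_apply, h1, h2,
      RingHom.id_apply, smul_sub]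

/-- The covariant exterior derivative of an `E`-valued 2-form, evaluated on vector fields. -/
def dOmega2 : Omega2 p q F E →ₗ[ℝ] (VF p q M → VF p q M → VF p q M → ∀ x, E x) where
  toFun b X Y Z x := D (fun y => b.1 y ![Y y, Z y]) x (X x)
    - D (fun y => b.1 y ![X y, Z y]) x (Y x)
    + D (fun y => b.1 y ![X y, Y y]) x (Z x)
    - b.1 x ![bracket X Y x, Z x]
    + b.1 x ![bracket X Z x, Y x]
    - b.1 x ![bracket Y Z x, X x]
  map_add' e f := by
    funext X Y Z x
    have h1 := cov_add D (e.2 Y Z) (f.2 Y Z) x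
    have h2 := cov_add D (e.2 X Z) (f.2 X Z) x
    have h3 := cov_add D (e.2 X Y) (f.2 X Y) x
    simp only [Submodule.coe_add, Pi.add_apply, ContinuousAlternatingMap.add_apply,
      add_apply, h1, h2, h3]
    abel
  map_smul' c e := by
    funext X Y Z x
    have h1 := cov_smul D c (e.2 Y Z) x
    have h2 := cov_smul D c (e.2 X Z) x
    have h3 := cov_smul D c (e.2 X Y) x
    simp only [Submodule.coe_smul, Pi.smul_apply, ContinuousAlternatingMap.smul_apply,
      smul_apply, h1, h2, h3, RingHom.id_apply, smul_sub, smul_add]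

variable (p q F E) in
/-- The evaluation of 2-forms on vector fields. -/
def evalForm2 : Omega2 p q F E →ₗ[ℝ] (VF p q M → VF p q M → ∀ x, E x) where
  toFun b X Y x := b.1 x ![X x, Y x]
  map_add' _ _ := rfl
  map_smul' _ _ := rfl

/-- The 2-forms `b` with `d_D b = 0`. -/
def cocycles2 : Submodule ℝ (Omega2 p q F E) := LinearMap.ker (dOmega2 D)

/-- The 2-forms `b` with `b = d_D e` for some `E`-valued 1-form `e`. -/
def coboundaries2 : Submodule ℝ (Omega2 p q F E) :=
  (LinearMap.range (dOmega1 D)).comap (evalForm2 p q F E)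

instance : AddCommGroup (cocycles2 D) := Submodule.addCommGroup _

/-- The twisted cohomology `H²_D(M,E)`. -/
abbrev H2 : Type _ := cocycles2 D ⧸ (coboundaries2 D).submoduleOf (cocycles2 D)

end Cohomology

end Bundle

end HigherGauge

end

/-! A trivialization of the 2-bundle over U_i gives isometric coordinates u_i of sections of E, with
u_i = g_ij u_j. The gluing law of A says exactly that g_ij (d + A_j) u_j = (d + A_i) u_i
(`TwoConnection.localCov_eq`), so the operators d + A_i define one connection D on E (`conn`,
`isConnection_conn`). Likewise the law B_i = g_ij B_j makes the B_i a single E-valued 2-form β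
(`twoForm`, `isTwoForm_twoForm`).

The properties of D and β are then checked in the coordinates of one patch. D preserves the metric
because the metric becomes constant there and A_i takes values in the Lorentz algebra. The curvature
of D becomes dA_i + A_i ∧ A_i (`isFlatConnection`), and d_D β becomes dB_i + A_i ∧ B_i
(`dOmega2_eq_zero`); both vanish by flatness of the 2-connection. Hence β is a cocycle, and H²_D = 0
makes it d_D e.

The analytic input is that a Lie bracket acts on functions as the commutator of derivations
(`mvfderiv_bracket`), together with the smoothness of coordinates in a smooth frame
(`SmoothFrameAt`), from which the smoothness of transition functions, D and β follows. -/

namespace HigherGauge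

/-! ### Calculus on M: smooth families of linear maps, product rules, the bracket as a commutator.
-/

section Analysis

variable {p q : ℕ} {M : Type*} [TopologicalSpace M]
  [ChartedSpace (EuclideanSpace ℝ (Fin (p + q))) M]
  {V W : Type*} [NormedAddCommGroup V] [NormedSpace ℝ V] [NormedAddCommGroup W] [NormedSpace ℝ W]

/-- A family of linear maps on a finite-dimensional space is smooth if it is so pointwise. -/
theorem contMDiffAt_clm_of_apply [FiniteDimensional ℝ V] {f : M → V →L[ℝ] W} {x : M}
    (h : ∀ v, ContMDiffAt (𝓡 (p + q)) 𝓘(ℝ, W) ∞ (fun y => f y v) x) :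
    ContMDiffAt (𝓡 (p + q)) 𝓘(ℝ, V →L[ℝ] W) ∞ f x := by
  -- Coordinates on V turn a linear map into the tuple of its values on a basis.
  let e₁ : V ≃L[ℝ] Fin (Module.finrank ℝ V) → ℝ := ContinuousLinearEquiv.ofFinrankEq (by simp)
  let e₂ := (e₁.arrowCongr (1 : W ≃L[ℝ] W)).trans
    (ContinuousLinearEquiv.piRing (Fin (Module.finrank ℝ V)))
  have h' : ContMDiffAt (𝓡 (p + q)) 𝓘(ℝ, Fin (Module.finrank ℝ V) → W) ∞ (fun y => e₂ (f y)) x :=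
    contMDiffAt_pi_space.2 fun i => h _
  have := (e₂.symm.contDiff (n := ∞)).contMDiff.contMDiffAt.comp x h'
  refine this.congr_of_eventuallyEq (Filter.Eventually.of_forall fun y => ?_)
  exact (e₂.symm_apply_apply (f y)).symm

/-- The inverse of a smooth family of linear isomorphisms is smooth. -/
theorem contMDiffAt_clm_symm [FiniteDimensional ℝ V] {f : M → V ≃L[ℝ] W} {x : M}
    (h : ContMDiffAt (𝓡 (p + q)) 𝓘(ℝ, V →L[ℝ] W) ∞ (fun y => (f y : V →L[ℝ] W)) x) :
    ContMDiffAt (𝓡 (p + q)) 𝓘(ℝ, W →L[ℝ] V) ∞ (fun y => ((f y).symm : W →L[ℝ] V)) x := by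
  have : CompleteSpace V := FiniteDimensional.complete ℝ V
  have h1 : ContDiffAt ℝ ∞ (ContinuousLinearMap.inverse : (V →L[ℝ] W) → W →L[ℝ] V)
    (f x : V →L[ℝ] W) := contDiffAt_map_inverse (f x)
  have := h1.contMDiffAt.comp x h
  refine this.congr_of_eventuallyEq (Filter.Eventually.of_forall fun y => ?_)
  exact (ContinuousLinearMap.inverse_equiv (f y)).symm

/-- The product rule for a continuous bilinear map. -/
theorem mvfderiv_bilin {V' : Type*} [NormedAddCommGroup V'] [NormedSpace ℝ V']
    (b : V →L[ℝ] V' →L[ℝ] W) {f : M → V} {g : M → V'} {x : M}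
    (hf : MDifferentiableAt (𝓡 (p + q)) 𝓘(ℝ, V) f x)
    (hg : MDifferentiableAt (𝓡 (p + q)) 𝓘(ℝ, V') g x) (v : TangentSpace (𝓡 (p + q)) x) :
    mvfderiv (𝓡 (p + q)) (fun y => b (f y) (g y)) x v =
      b (f x) (mvfderiv (𝓡 (p + q)) g x v) + b (mvfderiv (𝓡 (p + q)) f x v) (g x) := by
  have hf' := hf.hasMFDerivAt
  have hg' := hg.hasMFDerivAt
  have key : HasMFDerivAt (𝓡 (p + q)) 𝓘(ℝ, W) (fun y => b (f y) (g y)) x _ :=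
    ⟨b.isBoundedBilinearMap.continuous.continuousAt.comp (hf'.1.prodMk hg'.1),
      b.hasFDerivWithinAt_of_bilinear hf'.2 hg'.2⟩
  rw [mvfderiv, key.mfderiv]
  simp [mvfderiv]
  rfl

theorem mvfderiv_clm_apply {f : M → V →L[ℝ] W} {u : M → V} {x : M}
    (hf : MDifferentiableAt (𝓡 (p + q)) 𝓘(ℝ, V →L[ℝ] W) f x)
    (hu : MDifferentiableAt (𝓡 (p + q)) 𝓘(ℝ, V) u x) (v : TangentSpace (𝓡 (p + q)) x) :
    mvfderiv (𝓡 (p + q)) (fun y => f y (u y)) x v =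
      f x (mvfderiv (𝓡 (p + q)) u x v) + mvfderiv (𝓡 (p + q)) f x v (u x) :=
  mvfderiv_bilin (ContinuousLinearMap.id ℝ (V →L[ℝ] W)) hf hu v

theorem mvfderiv_const_clm (L : V →L[ℝ] W) {u : M → V} {x : M}
    (hu : MDifferentiableAt (𝓡 (p + q)) 𝓘(ℝ, V) u x) (v : TangentSpace (𝓡 (p + q)) x) :
    mvfderiv (𝓡 (p + q)) (fun y => L (u y)) x v = L (mvfderiv (𝓡 (p + q)) u x v) := by
  rw [mvfderiv_clm_apply (f := fun _ => L) mdifferentiableAt_const hu v, mvfderiv_const]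
  simp

theorem mvfderiv_congr {u u' : M → W} {x : M} (h : u =ᶠ[nhds x] u')
    (v : TangentSpace (𝓡 (p + q)) x) :
    mvfderiv (𝓡 (p + q)) u x v = mvfderiv (𝓡 (p + q)) u' x v := by
  have : mfderiv (𝓡 (p + q)) 𝓘(ℝ, W) u x v = mfderiv (𝓡 (p + q)) 𝓘(ℝ, W) u' x v := by
    rw [h.mfderiv_eq]
    rfl
  exact this

variable [IsManifold (𝓡 (p + q)) ∞ M]

/-- The derivative of a smooth function along a smooth vector field is smooth. -/
theorem contMDiffAt_mvfderiv_apply {u : M → W} {x : M}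
    (hu : ContMDiffAt (𝓡 (p + q)) 𝓘(ℝ, W) ∞ u x) (X : VF p q M) :
    ContMDiffAt (𝓡 (p + q)) 𝓘(ℝ, W) ∞ (fun y => mvfderiv (𝓡 (p + q)) u y (X y)) x := by
  have h1 := hu.mfderiv_const (m := ∞) (by simp)
  have h2 := ContMDiffAt.clm_apply_of_inCoordinates (ϕ := fun y => mfderiv (𝓡 (p + q)) 𝓘(ℝ, W) u y)
    h1 (X.contMDiff x) hu
  rw [contMDiffAt_totalSpace] at h2
  simpa using! h2.2


/-- The Lie bracket acts on functions as the commutator of derivations, for real functions. -/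
theorem mvfderiv_bracket_real {f : M → ℝ} {x : M}
    (hf : ContMDiffAt (𝓡 (p + q)) 𝓘(ℝ, ℝ) ∞ f x) (X Y : VF p q M) :
    mvfderiv (𝓡 (p + q)) f x (bracket X Y x) =
      mvfderiv (𝓡 (p + q)) (fun y => mvfderiv (𝓡 (p + q)) f y (Y y)) x (X x)
      - mvfderiv (𝓡 (p + q)) (fun y => mvfderiv (𝓡 (p + q)) f y (X y)) x (Y x) := by
  -- The method needs a nonzero tangent vector; if there is none, both sides are zero.
  rcases subsingleton_or_nontrivial (TangentSpace (𝓡 (p + q)) x) with hs | hs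
  · rw [bracket, Subsingleton.elim (VectorField.mlieBracket _ _ _ x) 0, Subsingleton.elim (X x) 0,
      Subsingleton.elim (Y x) 0]
    simp
  -- Let Z be a field, smooth at x, with Z(x) = w. The Jacobi identity for X, Y, fZ, expanded by the
  -- product rule, minus f times the identity for X, Y, Z, leaves ([X,Y]f - X(Yf) + Y(Xf)) Z = 0 at
  -- x. Since w ≠ 0, the coefficient vanishes.
  obtain ⟨w, hw⟩ := exists_ne (0 : TangentSpace (𝓡 (p + q)) x)
  have hW := FiberBundle.contMDiffAt_extend (k := ∞) (𝓡 (p + q)) (EuclideanSpace ℝ (Fin (p + q))) w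
  have hWx : FiberBundle.extend (EuclideanSpace ℝ (Fin (p + q))) w x = w := by simp
  generalize FiberBundle.extend (EuclideanSpace ℝ (Fin (p + q))) w = Z at hW hWx
  have two : minSmoothness ℝ 2 ≤ ∞ := by
    rw [minSmoothness_of_isRCLikeNormedField]
    exact ENat.LEInfty.out
  have one : (1 : ℕ∞ω) ≤ ∞ := ENat.LEInfty.out
  have : IsManifold (𝓡 (p + q)) (minSmoothness ℝ 2) M := IsManifold.of_le two
  have three : minSmoothness ℝ 3 ≤ ∞ := by
    rw [minSmoothness_of_isRCLikeNormedField]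
    exact ENat.LEInfty.out
  have : IsManifold (𝓡 (p + q)) (minSmoothness ℝ 3) M := IsManifold.of_le three
  have : IsManifold (𝓡 (p + q)) (((2 : ℕ∞) : ℕ∞ω) + 1) M := IsManifold.of_le (n := ∞) (by
    norm_num; exact ENat.LEInfty.out)
  have hXs := X.contMDiff x
  have hYs := Y.contMDiff x
  have hf1 : ∀ᶠ y in nhds x, MDifferentiableAt (𝓡 (p + q)) 𝓘(ℝ, ℝ) f y :=
    ((contMDiffAt_iff_contMDiffAt_nhds (by simp)).1 (hf.of_le one)).mono
      fun y h => h.mdifferentiableAt one_ne_zero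
  have hZ1 : ∀ᶠ y in nhds x, MDifferentiableAt (𝓡 (p + q)) (𝓡 (p + q)).tangent
      (fun y => (Z y : TangentBundle (𝓡 (p + q)) M)) y :=
    ((contMDiffAt_iff_contMDiffAt_nhds (by simp)).1 (hW.of_le one)).mono
      fun y h => h.mdifferentiableAt one_ne_zero
  -- Inner brackets must be differentiable at x for the product rule to apply to the outer ones.
  have br : ∀ {U U' : ∀ y : M, TangentSpace (𝓡 (p + q)) y},
      ContMDiffAt (𝓡 (p + q)) (𝓡 (p + q)).tangent ∞
        (fun y => (U y : TangentBundle (𝓡 (p + q)) M)) x →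
      ContMDiffAt (𝓡 (p + q)) (𝓡 (p + q)).tangent ∞
        (fun y => (U' y : TangentBundle (𝓡 (p + q)) M)) x →
      MDifferentiableAt (𝓡 (p + q)) (𝓡 (p + q)).tangent
        (fun y => (VectorField.mlieBracket (𝓡 (p + q)) U U' y : TangentBundle (𝓡 (p + q)) M)) x :=
    fun hU hU' => (ContMDiffAt.mlieBracket_vectorField (m := 1) (n := 2)
      (hU.of_le ENat.LEInfty.out) (hU'.of_le ENat.LEInfty.out)
      (by rw [minSmoothness_of_isRCLikeNormedField]; norm_num)).mdifferentiableAt one_ne_zero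
  have expand : ∀ U U' : VF p q M,
      VectorField.mlieBracket (𝓡 (p + q)) (fun y => U y)
        (VectorField.mlieBracket (𝓡 (p + q)) (fun y => U' y) (f • Z)) x =
      mvfderiv (𝓡 (p + q)) (fun y => mvfderiv (𝓡 (p + q)) f y (U' y)) x (U x) • Z x
      + mvfderiv (𝓡 (p + q)) f x (U' x) •
        VectorField.mlieBracket (𝓡 (p + q)) (fun y => U y) Z x
      + (mvfderiv (𝓡 (p + q)) f x (U x) •
        VectorField.mlieBracket (𝓡 (p + q)) (fun y => U' y) Z x
      + f x • VectorField.mlieBracket (𝓡 (p + q)) (fun y => U y)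
        (VectorField.mlieBracket (𝓡 (p + q)) (fun y => U' y) Z) x) := by
    intro U U'
    -- The outer bracket differentiates the inner one, so the product rule for the latter is needed
    -- in a neighbourhood of x.
    have e : VectorField.mlieBracket (𝓡 (p + q)) (fun y => U' y) (f • Z) =ᶠ[nhds x]
        (fun y => mvfderiv (𝓡 (p + q)) f y (U' y)) • Z
          + f • VectorField.mlieBracket (𝓡 (p + q)) (fun y => U' y) Z := by
      filter_upwards [hf1, hZ1] with y h1 h2
      exact VectorField.mlieBracket_smul_right h1 h2
    have hd := (contMDiffAt_mvfderiv_apply hf U').mdifferentiableAt (by simp)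
    have hb := br (U'.contMDiff x) hW
    rw [(Filter.EventuallyEq.refl _ _).mlieBracket_vectorField_eq e,
      VectorField.mlieBracket_add_right, VectorField.mlieBracket_smul_right hd hZ1.self_of_nhds,
      VectorField.mlieBracket_smul_right hf1.self_of_nhds hb]
    · exact hd.smul_section hZ1.self_of_nhds
    · exact hf1.self_of_nhds.smul_section hb
  have jac := VectorField.leibniz_identity_mlieBracket_apply (W := f • Z) (hXs.of_le two)
    (hYs.of_le two) ((hf.smul_section hW).of_le two)
  have jac' := VectorField.leibniz_identity_mlieBracket_apply (hXs.of_le two)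
    (hYs.of_le two) (hW.of_le two)
  rw [expand X Y, expand Y X, VectorField.mlieBracket_smul_right hf1.self_of_nhds
    hZ1.self_of_nhds, jac'] at jac
  have : (mvfderiv (𝓡 (p + q)) f x (bracket X Y x)
      - (mvfderiv (𝓡 (p + q)) (fun y => mvfderiv (𝓡 (p + q)) f y (Y y)) x (X x)
      - mvfderiv (𝓡 (p + q)) (fun y => mvfderiv (𝓡 (p + q)) f y (X y)) x (Y x))) • w = 0 := by
    rw [← hWx, bracket]
    -- The terms with single brackets [X,Z] and [Y,Z] cancel, being symmetric in X and Y, and so do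
    -- the terms with factor f(x).
    linear_combination (norm := module) -jac
  exact sub_eq_zero.1 ((smul_eq_zero.1 this).resolve_right hw)

/-- The Lie bracket acts on functions as the commutator of derivations. -/
theorem mvfderiv_bracket {u : M → W} {x : M}
    (hu : ContMDiffAt (𝓡 (p + q)) 𝓘(ℝ, W) ∞ u x) (X Y : VF p q M) :
    mvfderiv (𝓡 (p + q)) u x (bracket X Y x) =
      mvfderiv (𝓡 (p + q)) (fun y => mvfderiv (𝓡 (p + q)) u y (Y y)) x (X x)
      - mvfderiv (𝓡 (p + q)) (fun y => mvfderiv (𝓡 (p + q)) u y (X y)) x (Y x) := by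
  have hd : ∀ U : VF p q M, MDifferentiableAt (𝓡 (p + q)) 𝓘(ℝ, W)
      (fun y => mvfderiv (𝓡 (p + q)) u y (U y)) x := fun U =>
    (contMDiffAt_mvfderiv_apply hu U).mdifferentiableAt (by simp)
  have hu1 : ∀ᶠ y in nhds x, MDifferentiableAt (𝓡 (p + q)) 𝓘(ℝ, W) u y :=
    ((contMDiffAt_iff_contMDiffAt_nhds (n := 1) (by simp)).1 (hu.of_le ENat.LEInfty.out)).mono
      fun y h => h.mdifferentiableAt one_ne_zero
  -- Continuous linear functionals separate the points of W and commute with derivatives, which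
  -- reduces the claim to real functions.
  refine (SeparatingDual.eq_iff_forall_dual_eq (R := ℝ)).2 fun L => ?_
  have e : ∀ U : VF p q M, (fun y => L (mvfderiv (𝓡 (p + q)) u y (U y))) =ᶠ[nhds x]
      fun y => mvfderiv (𝓡 (p + q)) (fun z => L (u z)) y (U y) := fun U =>
    hu1.mono fun y h => (mvfderiv_const_clm L h (U y)).symm
  rw [map_sub, ← mvfderiv_const_clm L hu1.self_of_nhds, ← mvfderiv_const_clm L (hd Y),
    ← mvfderiv_const_clm L (hd X), mvfderiv_congr (e Y), mvfderiv_congr (e X)]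
  exact mvfderiv_bracket_real (L.contDiff.contMDiff.contMDiffAt.comp x hu) X Y

end Analysis

/-! ### Smooth sections and smooth frames of vector bundles. -/

section Sections

variable {p q : ℕ} {M : Type*} [TopologicalSpace M]
  [ChartedSpace (EuclideanSpace ℝ (Fin (p + q))) M] [IsManifold (𝓡 (p + q)) ∞ M]
  {F : Type*} [NormedAddCommGroup F] [NormedSpace ℝ F]
  {E : M → Type*} [TopologicalSpace (TotalSpace F E)]
  [∀ x, AddCommGroup (E x)] [∀ x, Module ℝ (E x)] [∀ x, TopologicalSpace (E x)]
  [∀ x, IsTopologicalAddGroup (E x)] [∀ x, ContinuousSMul ℝ (E x)]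
  [FiberBundle F E] [VectorBundle ℝ F E]

/-- A local frame field of the tangent bundle extends, near a point, to a global vector field. -/
theorem exists_vectorField_eventuallyEq_symm [T2Space M] (x : M)
    (v : EuclideanSpace ℝ (Fin (p + q))) :
    ∃ X : VF p q M, ∀ᶠ y in nhds x, X y = (trivializationAt (EuclideanSpace ℝ (Fin (p + q)))
      (TangentSpace (𝓡 (p + q)) : M → Type _) x).symm y v := by
  set e := trivializationAt (EuclideanSpace ℝ (Fin (p + q)))
      (TangentSpace (𝓡 (p + q)) : M → Type _) x with he
  have hx : x ∈ e.baseSet := mem_baseSet_trivializationAt _ _ x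
  -- The bump function ψ is 1 near x and supported in the domain of the trivialization, so its
  -- product with the field of constant coordinates v extends smoothly to M.
  obtain ⟨ψ, -, hψ⟩ := (SmoothBumpFunction.nhds_basis_tsupport (I := 𝓡 (p + q)) x).mem_iff.1
    (e.open_baseSet.mem_nhds hx)
  have hs : ContMDiffOn (𝓡 (p + q)) (𝓡 (p + q)).tangent ∞
      (fun y => (e.symm y v : TangentBundle (𝓡 (p + q)) M)) e.baseSet := by
    refine (e.contMDiffOn_section_baseSet_iff).2 (contMDiffOn_const (c := v) |>.congr fun y hy => ?_)
    simp [e.apply_mk_symm hy]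
  refine ⟨⟨_, ContMDiffOn.smul_section_of_tsupport (ψ := ψ) ψ.contMDiff.contMDiffOn e.open_baseSet
    hψ hs⟩, ?_⟩
  filter_upwards [ψ.eventuallyEq_one] with y hy
  change ψ y • e.symm y v = e.symm y v
  rw [hy, Pi.one_apply, one_smul]

/-- An `E`-valued 1-form is smooth as a section of `Hom(TM, E)` if its values on smooth vector
fields are smooth. -/
theorem contMDiffAt_hom_of_apply [T2Space M]
    {Φ : ∀ x : M, TangentSpace (𝓡 (p + q)) x →L[ℝ] E x} {x : M}
    (h : ∀ X : VF p q M, ContMDiffAt (𝓡 (p + q)) ((𝓡 (p + q)).prod 𝓘(ℝ, F)) ∞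
      (fun y => TotalSpace.mk' F y (Φ y (X y))) x) :
    ContMDiffAt (𝓡 (p + q)) ((𝓡 (p + q)).prod 𝓘(ℝ, EuclideanSpace ℝ (Fin (p + q)) →L[ℝ] F)) ∞
      (fun y => TotalSpace.mk' (EuclideanSpace ℝ (Fin (p + q)) →L[ℝ] F)
        (E := fun y => TangentSpace (𝓡 (p + q)) y →L[ℝ] E y) y (Φ y)) x := by
  refine contMDiffAt_hom_bundle _ |>.2 ⟨contMDiffAt_id, contMDiffAt_clm_of_apply fun v => ?_⟩
  -- Read in the trivializations, the matrix of Φ applied to v is near x the value of Φ on a global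
  -- field with constant coordinates v.
  obtain ⟨X, hX⟩ := exists_vectorField_eventuallyEq_symm x v
  refine ((contMDiffAt_section x).1 (h X)).congr_of_eventuallyEq ?_
  filter_upwards [hX, (trivializationAt F E x).open_baseSet.mem_nhds
    (mem_baseSet_trivializationAt F E x), (trivializationAt (EuclideanSpace ℝ (Fin (p + q)))
      (TangentSpace (𝓡 (p + q)) : M → Type _) x).open_baseSet.mem_nhds
    (mem_baseSet_trivializationAt _ _ x)] with y hy h1 h2
  rw [hy]
  simp [ContinuousLinearMap.inCoordinates, Trivialization.coe_linearMapAt_of_mem _ h1,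
    Trivialization.symmL_apply _ h2]

variable {V : Type*} [NormedAddCommGroup V] [NormedSpace ℝ V] [FiniteDimensional ℝ V]

variable (p q F) in
/-- A family of frames of `E` is smooth at `x` if all its constant combinations are. -/
def SmoothFrameAt (c : ∀ y, E y ≃L[ℝ] V) (x : M) : Prop :=
  ∀ v, ContMDiffAt (𝓡 (p + q)) ((𝓡 (p + q)).prod 𝓘(ℝ, F)) ∞
    (fun y => TotalSpace.mk' F y ((c y).symm v)) x

variable {c c' : ∀ y, E y ≃L[ℝ] V} {x : M}

namespace SmoothFrameAt

/-- A smooth frame, read in a trivialization of `E`. -/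
theorem exists_matrix (hc : SmoothFrameAt p q F c x) :
    ∃ G : M → V ≃L[ℝ] F, ContMDiffAt (𝓡 (p + q)) 𝓘(ℝ, V →L[ℝ] F) ∞ (fun y => (G y : V →L[ℝ] F)) x ∧
      ∀ᶠ y in nhds x, ∀ v, (trivializationAt F E x ⟨y, (c y).symm v⟩).2 = G y v := by
  classical
  let e := trivializationAt F E x
  -- `G y` has to be an isomorphism at every y, so that it can be inverted; off the base set an
  -- arbitrary one is inserted, as only the germ at x matters.
  let G : M → V ≃L[ℝ] F := fun y => (c y).symm.trans
    (if hy : y ∈ e.baseSet then e.continuousLinearEquivAt ℝ y hy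
      else VectorBundle.continuousLinearEquivAt ℝ F E y)
  have hG : ∀ᶠ y in nhds x, ∀ v, (e ⟨y, (c y).symm v⟩).2 = G y v := by
    filter_upwards [e.open_baseSet.mem_nhds (mem_baseSet_trivializationAt F E x)] with y hy v
    simp [G, hy]
  refine ⟨G, contMDiffAt_clm_of_apply fun v => ?_, hG⟩
  exact ((contMDiffAt_section x).1 (hc v)).congr_of_eventuallyEq (hG.mono fun y h => (h v).symm)

/-- The inverse of the matrix in `exists_matrix`. It factors the coordinates of any section through
its fibre component in the bundle trivialization, so smoothness and differentiability both pass to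
coordinates. -/
theorem exists_coordinates (hc : SmoothFrameAt p q F c x) :
    ∃ G : M → F →L[ℝ] V, ContMDiffAt (𝓡 (p + q)) 𝓘(ℝ, F →L[ℝ] V) ∞ G x ∧
      ∀ᶠ y in nhds x, ∀ s : E y, c y s = G y (trivializationAt F E x ⟨y, s⟩).2 := by
  obtain ⟨G, hG, h⟩ := hc.exists_matrix
  refine ⟨_, contMDiffAt_clm_symm hG, h.mono fun y hy s => ?_⟩
  have := hy (c y s)
  rw [(c y).symm_apply_apply] at this
  rw [this]
  exact ((G y).symm_apply_apply _).symm

/-- The coordinates of a smooth section in a smooth frame are smooth. -/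
theorem contMDiffAt_coord (hc : SmoothFrameAt p q F c x) {s : ∀ y, E y}
    (hs : ContMDiffAt (𝓡 (p + q)) ((𝓡 (p + q)).prod 𝓘(ℝ, F)) ∞
      (fun y => TotalSpace.mk' F y (s y)) x) :
    ContMDiffAt (𝓡 (p + q)) 𝓘(ℝ, V) ∞ (fun y => c y (s y)) x := by
  obtain ⟨G, hG, h⟩ := hc.exists_coordinates
  exact (hG.clm_apply ((contMDiffAt_section x).1 hs)).congr_of_eventuallyEq
    (h.mono fun y hy => hy (s y))

theorem mdifferentiableAt_coord (hc : SmoothFrameAt p q F c x) {s : ∀ y, E y}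
    (hs : MDifferentiableAt (𝓡 (p + q)) ((𝓡 (p + q)).prod 𝓘(ℝ, F))
      (fun y => TotalSpace.mk' F y (s y)) x) :
    MDifferentiableAt (𝓡 (p + q)) 𝓘(ℝ, V) (fun y => c y (s y)) x := by
  obtain ⟨G, hG, h⟩ := hc.exists_coordinates
  exact ((hG.mdifferentiableAt (by simp)).clm_apply
    ((mdifferentiableAt_section _ _).1 hs)).congr_of_eventuallyEq (h.mono fun y hy => hy (s y))

/-- A section with smooth coordinates in a smooth frame is smooth. -/
theorem contMDiffAt_symm (hc : SmoothFrameAt p q F c x) {u : M → V}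
    (hu : ContMDiffAt (𝓡 (p + q)) 𝓘(ℝ, V) ∞ u x) :
    ContMDiffAt (𝓡 (p + q)) ((𝓡 (p + q)).prod 𝓘(ℝ, F)) ∞
      (fun y => TotalSpace.mk' F y ((c y).symm (u y))) x := by
  obtain ⟨G, hG, h⟩ := hc.exists_matrix
  exact (contMDiffAt_section x).2 ((hG.clm_apply hu).congr_of_eventuallyEq
    (h.mono fun y hy => hy (u y)))

/-- The change between two smooth frames is smooth. -/
theorem contMDiffAt_change (hc : SmoothFrameAt p q F c x) (hc' : SmoothFrameAt p q F c' x) :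
    ContMDiffAt (𝓡 (p + q)) 𝓘(ℝ, V →L[ℝ] V) ∞
      (fun y => ((c y : E y →L[ℝ] V).comp ((c' y).symm : V →L[ℝ] E y))) x :=
  contMDiffAt_clm_of_apply fun v => hc.contMDiffAt_coord (hc' v)

end SmoothFrameAt

end Sections

/-! ### Gluing the local data to a connection and a 2-form on E. -/

section Connection

variable {p q : ℕ} {M : Type*} [TopologicalSpace M]
  [ChartedSpace (EuclideanSpace ℝ (Fin (p + q))) M] [IsManifold (𝓡 (p + q)) ∞ M]
  {F : Type*} [NormedAddCommGroup F] [NormedSpace ℝ F]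
  {E : M → Type*} [TopologicalSpace (TotalSpace F E)]
  [∀ x, AddCommGroup (E x)] [∀ x, Module ℝ (E x)] [∀ x, TopologicalSpace (E x)]
  [∀ x, IsTopologicalAddGroup (E x)] [∀ x, ContinuousSMul ℝ (E x)]
  [FiberBundle F E] [VectorBundle ℝ F E] {T : FakeTangentBundle p q F E}

namespace FakeTangentBundle.LocalTrivialization

/-- The local section of the frame bundle which corresponds to a local trivialization is given by
the inverse of the induced trivialization of `E`, so the latter is smooth. -/
theorem smoothFrameAt_coord (τ : T.LocalTrivialization) {x : M} (hx : x ∈ τ.base) :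
    SmoothFrameAt p q F τ.coord x := by
  -- `someFrame` is a mere choice at each point and need not vary continuously. Correcting it by h⁻¹
  -- gives the section which the trivialization sends to 1, and this one is smooth.
  let h : M → Lorentz p q := fun y => τ.toObj (mkObj ⟨y, T.someFrame y⟩ 1)
  have := τ.smooth (fun y => (T.someFrame y).act (h y)⁻¹) fun y hy => by
    have e : mkObj (⟨y, (T.someFrame y).act (h y)⁻¹⟩ : T.FrameBundle) 1 =
        actObj (mkObj ⟨y, T.someFrame y⟩ 1) (h y)⁻¹ := by
      change _ = mkObj _ (1 * (h y)⁻¹)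
      refine mkObj_eq.2 ⟨h y, rfl, by simp⟩
    rw [e, τ.map_actObj (mkObj ⟨y, T.someFrame y⟩ 1) (h y)⁻¹ hy]
    exact mul_inv_cancel _
  intro v
  exact (this v).contMDiffAt (τ.isOpen_base.mem_nhds hx)

/-- Both coordinates and the transition function are built from the same `someFrame x`, so the
choice cancels, even at points outside the bases. -/
theorem coord_eq (τ σ : T.LocalTrivialization) (x : M) (s : E x) :
    τ.coord x s = toEnd (τ.transition σ x) (σ.coord x s) := by
  change _ = (τ.toObj (mkObj ⟨x, T.someFrame x⟩ 1) : Rpq p q ≃L[ℝ] Rpq p q)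
    ((σ.toObj (mkObj ⟨x, T.someFrame x⟩ 1) : Rpq p q ≃L[ℝ] Rpq p q).symm (σ.coord x s))
  simp [coord]

theorem coord_symm_eq (τ σ : T.LocalTrivialization) (x : M) (v : Rpq p q) :
    τ.coord x ((σ.coord x).symm v) = toEnd (τ.transition σ x) v := by
  rw [coord_eq τ σ, ContinuousLinearEquiv.apply_symm_apply]

/-- Smoothness of transition functions is not part of the data: it holds because they are the change
between two smooth frames of E. -/
theorem contMDiffAt_transition (τ σ : T.LocalTrivialization) {x : M} (hτ : x ∈ τ.base)
    (hσ : x ∈ σ.base) :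
    ContMDiffAt (𝓡 (p + q)) 𝓘(ℝ, Rpq p q →L[ℝ] Rpq p q) ∞
      (fun y => toEnd (τ.transition σ y)) x := by
  convert! (τ.smoothFrameAt_coord hτ).contMDiffAt_change (σ.smoothFrameAt_coord hσ) using 2 with y
  ext1 v
  exact (coord_symm_eq τ σ y v).symm

theorem transition_inv (τ σ : T.LocalTrivialization) (x : M) :
    (τ.transition σ x)⁻¹ = σ.transition τ x := by
  simp [transition]

/-- `coord` is the inverse of an isometric frame followed by an element of O(p,q). -/
theorem minkowski_coord (τ : T.LocalTrivialization) (x : M) (s t : E x) :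
    minkowski (τ.coord x s) (τ.coord x t) = T.metric x s t := by
  refine ((τ.toObj (mkObj ⟨x, T.someFrame x⟩ 1)).2 _ _).trans ?_
  rw [← (T.someFrame x).2]
  simp

end FakeTangentBundle.LocalTrivialization

/-- The metric of `ℝ^{p,q}` as a continuous bilinear form. -/
noncomputable def minkowskiForm (p q : ℕ) : Rpq p q →L[ℝ] Rpq p q →L[ℝ] ℝ :=
  LinearMap.toContinuousBilinearMap (LinearMap.mk₂ ℝ minkowski minkowski_add_left
    minkowski_smul_left minkowski_add_right minkowski_smul_right)

theorem minkowskiForm_apply (v w : Rpq p q) : minkowskiForm p q v w = minkowski v w := rfl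

namespace TwoConnection

open FakeTangentBundle

variable {ι : Type*} (C : TwoConnection T ι)

/-- The covariant derivative `d + A` in one of the local trivializations. -/
noncomputable def localCov (i : ι) (s : ∀ y, E y) (x : M) : TangentSpace (𝓡 (p + q)) x →L[ℝ] E x :=
  ((C.triv i).coord x).symm.toContinuousLinearMap.comp
    (mvfderiv (𝓡 (p + q)) (fun y => (C.triv i).coord y (s y)) x
      + (ContinuousLinearMap.apply ℝ (Rpq p q) ((C.triv i).coord x (s x))).comp (C.A i x))

theorem coord_localCov (i : ι) (s : ∀ y, E y) (x : M) (v : TangentSpace (𝓡 (p + q)) x) :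
    (C.triv i).coord x (C.localCov i s x v) =
      mvfderiv (𝓡 (p + q)) (fun y => (C.triv i).coord y (s y)) x v
        + C.A i x v ((C.triv i).coord x (s x)) := by
  simp [localCov]

/-- The transformation law of `A` says that the local covariant derivatives agree on overlaps. -/
theorem localCov_eq {i j : ι} {x : M} (hi : x ∈ (C.triv i).base) (hj : x ∈ (C.triv j).base)
    {s : ∀ y, E y} (hs : MDifferentiableAt (𝓡 (p + q)) ((𝓡 (p + q)).prod 𝓘(ℝ, F))
      (fun y => TotalSpace.mk' F y (s y)) x) :
    C.localCov i s x = C.localCov j s x := by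
  ext v
  apply ((C.triv i).coord x).injective
  -- Write u_j = g⁻¹ u_i. By the product rule, g (du_j + A_j u_j) = du_i + (g d(g⁻¹) + g A_j g⁻¹)
  -- u_i, and the bracket is A_i.
  set g := (C.triv i).transition (C.triv j) with hg
  have hgs' : MDifferentiableAt (𝓡 (p + q)) 𝓘(ℝ, Rpq p q →L[ℝ] Rpq p q)
      (fun y => toEnd (g y)⁻¹) x := by
    -- g⁻¹ is the transition function in the opposite direction, hence differentiable.
    simp only [hg, LocalTrivialization.transition_inv]
    exact ((C.triv j).contMDiffAt_transition (C.triv i) hj hi).mdifferentiableAt (by simp)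
  have hu' := ((C.triv i).smoothFrameAt_coord hi).mdifferentiableAt_coord hs
  have e : (fun y => (C.triv j).coord y (s y)) =
      fun y => toEnd (g y)⁻¹ ((C.triv i).coord y (s y)) := by
    funext y
    rw [hg, LocalTrivialization.transition_inv]
    exact LocalTrivialization.coord_eq _ _ _ _
  have gg : ∀ w, toEnd (g x) (toEnd (g x)⁻¹ w) = w := fun w =>
    (g x : Rpq p q ≃L[ℝ] Rpq p q).apply_symm_apply w
  have d := mvfderiv_clm_apply hgs' hu' v
  rw [← e] at d
  have hc : (C.triv j).coord x (s x) = toEnd (g x)⁻¹ ((C.triv i).coord x (s x)) :=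
    congrFun e x
  rw [LocalTrivialization.coord_eq (C.triv i) (C.triv j) x (C.localCov j s x v), coord_localCov,
    coord_localCov, d, hc, C.glue_A i j x ⟨hi, hj⟩ v]
  simp only [add_apply, mul_apply_eq_comp, map_add, ← hg, gg]
  abel

/-- A patch which contains a given point. -/
noncomputable def patch (x : M) : ι := (C.covers x).choose

theorem mem_patch (x : M) : x ∈ (C.triv (C.patch x)).base := (C.covers x).choose_spec

/-- The connection on `E` which is `d + A` in the local trivializations. -/
noncomputable def conn : CovariantDerivative (𝓡 (p + q)) F E where
  toFun s x := C.localCov (C.patch x) s x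
  isCovariantDerivativeOnUniv := by
    refine ⟨fun {s t x} hs ht _ => ?_, fun {s f x} hs hf _ => ?_⟩
    -- Additivity and the Leibniz rule at x involve only the patch chosen for x, so no comparison of
    -- patches is needed.
    all_goals
      have hx := C.mem_patch x
      generalize C.patch x = i at hx
      have hc := (C.triv i).smoothFrameAt_coord hx
      ext v
      apply ((C.triv i).coord x).injective
    · simp only [add_apply, Pi.add_apply, map_add, coord_localCov]
      rw [mvfderiv_fun_add (hc.mdifferentiableAt_coord hs) (hc.mdifferentiableAt_coord ht),
        add_apply]
      abel
    · simp only [add_apply, Pi.smul_apply', map_add, coord_localCov, map_smul, smul_apply,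
        ContinuousLinearMap.smulRight_apply]
      rw [mvfderiv_fun_smul hf (hc.mdifferentiableAt_coord hs)]
      simp
      abel

/-- The gluing law of A enters here, through `localCov_eq`: on differentiable sections the patch
chosen at a point does not matter. -/
theorem isConnection_conn : C.IsConnection C.conn := fun i x hx s hs v => by
  change (C.triv i).coord x (C.localCov (C.patch x) s x v) = _
  rw [C.localCov_eq (C.mem_patch x) hx hs, coord_localCov]

/-- The values of `B` in the local trivializations, as a 2-form with values in `E`. -/
noncomputable def twoForm (x : M) : TangentSpace (𝓡 (p + q)) x [⋀^Fin 2]→L[ℝ] E x :=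
  ((C.triv (C.patch x)).coord x).symm.toContinuousLinearMap.compContinuousAlternatingMap
    (C.B (C.patch x) x)

theorem isTwoForm_twoForm : C.IsTwoForm C.twoForm := fun i x hx v w => by
  rw [C.glue_B i (C.patch x) x ⟨hx, C.mem_patch x⟩]
  exact (LocalTrivialization.coord_symm_eq _ _ _ _).symm

end TwoConnection

end Connection

/-! ### Smoothness, metric, curvature and covariant exterior derivative in local coordinates. -/

section FlatConnection

variable {p q : ℕ} {M : Type*} [TopologicalSpace M]
  [ChartedSpace (EuclideanSpace ℝ (Fin (p + q))) M] [IsManifold (𝓡 (p + q)) ∞ M]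
  {F : Type*} [NormedAddCommGroup F] [NormedSpace ℝ F]
  {E : M → Type*} [TopologicalSpace (TotalSpace F E)]
  [∀ x, AddCommGroup (E x)] [∀ x, Module ℝ (E x)] [∀ x, TopologicalSpace (E x)]
  [∀ x, IsTopologicalAddGroup (E x)] [∀ x, ContinuousSMul ℝ (E x)]
  [FiberBundle F E] [VectorBundle ℝ F E] {T : FakeTangentBundle p q F E}

namespace TwoConnection

open FakeTangentBundle

variable {ι : Type*} {C : TwoConnection T ι} {D : CovariantDerivative (𝓡 (p + q)) F E}

theorem contMDiffAt_A (i : ι) {x : M} (hx : x ∈ (C.triv i).base) (X : VF p q M) :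
    ContMDiffAt (𝓡 (p + q)) 𝓘(ℝ, Rpq p q →L[ℝ] Rpq p q) ∞ (fun y => C.A i y (X y)) x :=
  (C.smooth_A i X).contMDiffAt ((C.triv i).isOpen_base.mem_nhds hx)

theorem contMDiffAt_B (i : ι) {x : M} (hx : x ∈ (C.triv i).base) (X Y : VF p q M) :
    ContMDiffAt (𝓡 (p + q)) 𝓘(ℝ, Rpq p q) ∞ (fun y => C.B i y ![X y, Y y]) x :=
  (C.smooth_B i X Y).contMDiffAt ((C.triv i).isOpen_base.mem_nhds hx)

/-- A connection which is `d + A` in the local trivializations maps smooth sections to smooth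
sections, along smooth vector fields. -/
theorem IsConnection.contMDiff_apply (hD : C.IsConnection D) {s : ∀ y, E y}
    (hs : ContMDiff (𝓡 (p + q)) ((𝓡 (p + q)).prod 𝓘(ℝ, F)) ∞
      (fun y => TotalSpace.mk' F y (s y))) (X : VF p q M) :
    ContMDiff (𝓡 (p + q)) ((𝓡 (p + q)).prod 𝓘(ℝ, F)) ∞
      (fun y => TotalSpace.mk' F y (D s y (X y))) := fun x => by
  obtain ⟨i, hx⟩ := C.covers x
  have hc := (C.triv i).smoothFrameAt_coord hx
  have hu := hc.contMDiffAt_coord (hs x)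
  refine (hc.contMDiffAt_symm ((contMDiffAt_mvfderiv_apply hu X).add
    ((contMDiffAt_A i hx X).clm_apply hu))).congr_of_eventuallyEq ?_
  filter_upwards [(C.triv i).isOpen_base.mem_nhds hx] with y hy
  congr 1
  rw [ContinuousLinearEquiv.eq_symm_apply, hD i y hy s ((hs y).mdifferentiableAt (by simp))]
  rfl

/-- Here D s must be smooth as a section of Hom(TM, E); by `contMDiffAt_hom_of_apply` it is enough
to test it on global vector fields. -/
theorem IsConnection.contMDiffCovariantDerivative [T2Space M] (hD : C.IsConnection D) :
    D.ContMDiffCovariantDerivative ∞ :=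
  ⟨⟨fun {s} hs => contMDiffOn_univ.2 fun _ => contMDiffAt_hom_of_apply fun X =>
    hD.contMDiff_apply (contMDiffOn_univ.1 (by simpa using hs)) X _⟩⟩

/-- A connection which is `d + A` in the local trivializations preserves the metric, because `A`
takes values in `𝔬(p,q)`. -/
theorem IsConnection.isMetricPreserving (hD : C.IsConnection D) : IsMetricPreserving T D := by
  intro X s t x
  obtain ⟨i, hx⟩ := C.covers x
  have hc := (C.triv i).smoothFrameAt_coord hx
  have hs := s.mdifferentiableAt (x := x)
  have ht := t.mdifferentiableAt (x := x)
  -- In isometric coordinates the metric is a constant bilinear form, so no derivative of the metric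
  -- appears.
  have e : (fun y => T.metric y (s y) (t y)) =
      fun y => minkowskiForm p q ((C.triv i).coord y (s y)) ((C.triv i).coord y (t y)) :=
    funext fun y => ((C.triv i).minkowski_coord y _ _).symm
  rw [e, mvfderiv_bilin _ (hc.mdifferentiableAt_coord hs) (hc.mdifferentiableAt_coord ht),
    ← (C.triv i).minkowski_coord, ← (C.triv i).minkowski_coord, hD i x hx _ hs, hD i x hx _ ht,
    minkowski_add_left, minkowski_add_right, minkowskiForm_apply, minkowskiForm_apply]
  linarith [C.A_mem i x (X x) ((C.triv i).coord x (s x)) ((C.triv i).coord x (t x))]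

/-- A second covariant derivative in a local trivialization. -/
theorem IsConnection.coord_cov_cov (hD : C.IsConnection D) (i : ι) {x : M}
    (hx : x ∈ (C.triv i).base) (s : ContMDiffSection (𝓡 (p + q)) F ∞ E) (X Y : VF p q M) :
    (C.triv i).coord x (D (fun y => D (fun z => s z) y (Y y)) x (X x)) =
      mvfderiv (𝓡 (p + q)) (fun y => mvfderiv (𝓡 (p + q))
          (fun z => (C.triv i).coord z (s z)) y (Y y)) x (X x)
      + (C.A i x (Y x) (mvfderiv (𝓡 (p + q)) (fun z => (C.triv i).coord z (s z)) x (X x))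
        + mvfderiv (𝓡 (p + q)) (fun y => C.A i y (Y y)) x (X x) ((C.triv i).coord x (s x)))
      + C.A i x (X x) (mvfderiv (𝓡 (p + q)) (fun z => (C.triv i).coord z (s z)) x (Y x)
        + C.A i x (Y x) ((C.triv i).coord x (s x))) := by
  have hu := ((C.triv i).smoothFrameAt_coord hx).contMDiffAt_coord (s.contMDiff x)
  have hA := contMDiffAt_A i hx Y
  rw [hD i x hx _ ((hD.contMDiff_apply s.contMDiff Y x).mdifferentiableAt (by simp)),
    hD i x hx _ s.mdifferentiableAt]
  congr 1
  rw [mvfderiv_congr (u' := fun y => mvfderiv (𝓡 (p + q))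
      (fun z => (C.triv i).coord z (s z)) y (Y y) + C.A i y (Y y) ((C.triv i).coord y (s y)))
      (Filter.eventually_of_mem ((C.triv i).isOpen_base.mem_nhds hx) fun y hy =>
        hD i y hy _ s.mdifferentiableAt (Y y)),
    mvfderiv_fun_add ((contMDiffAt_mvfderiv_apply hu Y).mdifferentiableAt (by simp))
      ((hA.clm_apply hu).mdifferentiableAt (by simp)), add_apply,
    mvfderiv_clm_apply (hA.mdifferentiableAt (by simp)) (hu.mdifferentiableAt (by simp))]

/-- The curvature of a connection which is `d + A` is `dA + A ∧ A`. -/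
theorem IsConnection.isFlatConnection (hD : C.IsConnection D)
    (h : ∀ i, ∀ X Y : VF p q M, ∀ x ∈ (C.triv i).base, C.curvature i X Y x = 0) :
    IsFlatConnection D := by
  intro X Y s x
  obtain ⟨i, hx⟩ := C.covers x
  have hu := ((C.triv i).smoothFrameAt_coord hx).contMDiffAt_coord (s.contMDiff x)
  apply ((C.triv i).coord x).injective
  have hF := congrArg (fun f : Rpq p q →L[ℝ] Rpq p q => f ((C.triv i).coord x (s x)))
    (h i X Y x hx)
  simp only [curvature, extDer1, add_apply, sub_apply, zero_apply,
    mul_apply_eq_comp] at hF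
  -- With u the coordinates of s, the second derivatives of u cancel against the derivative along
  -- [X,Y], and the terms A(X) Y(u) + A(Y) X(u) are symmetric in X and Y. What remains is the
  -- curvature applied to u.
  rw [map_zero, map_sub, map_sub, hD.coord_cov_cov i hx s X Y, hD.coord_cov_cov i hx s Y X,
    hD i x hx _ s.mdifferentiableAt, mvfderiv_bracket hu X Y, map_add, map_add, ← hF]
  abel

variable {β : ∀ x : M, TangentSpace (𝓡 (p + q)) x [⋀^Fin 2]→L[ℝ] E x}

theorem IsTwoForm.mem_Omega2 (hβ : C.IsTwoForm β) : β ∈ Omega2 p q F E := fun X Y x => by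
  obtain ⟨i, hx⟩ := C.covers x
  have hc := (C.triv i).smoothFrameAt_coord hx
  refine (hc.contMDiffAt_symm (contMDiffAt_B i hx X Y)).congr_of_eventuallyEq ?_
  filter_upwards [(C.triv i).isOpen_base.mem_nhds hx] with y hy
  rw [hβ i y hy, ContinuousLinearEquiv.symm_apply_apply]

/-- The derivative terms of `dOmega2` have this shape, up to sign and order of the fields; the
bracket terms are tensorial and need only the definition of `IsTwoForm`. -/
theorem IsTwoForm.coord_cov (hβ : C.IsTwoForm β) (hD : C.IsConnection D) (i : ι) {x : M}
    (hx : x ∈ (C.triv i).base) (X Y Z : VF p q M) :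
    (C.triv i).coord x (D (fun y => β y ![Y y, Z y]) x (X x)) =
      mvfderiv (𝓡 (p + q)) (fun y => C.B i y ![Y y, Z y]) x (X x)
        + C.A i x (X x) (C.B i x ![Y x, Z x]) := by
  rw [hD i x hx _ ((hβ.mem_Omega2 Y Z x).mdifferentiableAt (by simp)), ← hβ i x hx,
    mvfderiv_congr (u' := fun y => C.B i y ![Y y, Z y])
      (Filter.eventually_of_mem ((C.triv i).isOpen_base.mem_nhds hx) fun y hy =>
        (hβ i y hy _ _).symm)]

/-- The covariant exterior derivative of `B` is the 2-curvature `dB + A ∧ B`. -/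
theorem IsTwoForm.dOmega2_eq_zero (hβ : C.IsTwoForm β) (hD : C.IsConnection D)
    (h : ∀ i, ∀ X Y Z : VF p q M, ∀ x ∈ (C.triv i).base, C.twoCurvature i X Y Z x = 0) :
    dOmega2 D ⟨β, hβ.mem_Omega2⟩ = 0 := by
  funext X Y Z x
  obtain ⟨i, hx⟩ := C.covers x
  apply ((C.triv i).coord x).injective
  have hG := h i X Y Z x hx
  simp only [twoCurvature, extDer2, alphaInf] at hG
  change (C.triv i).coord x (D (fun y => β y ![Y y, Z y]) x (X x)
    - D (fun y => β y ![X y, Z y]) x (Y x) + D (fun y => β y ![X y, Y y]) x (Z x)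
    - β x ![bracket X Y x, Z x] + β x ![bracket X Z x, Y x] - β x ![bracket Y Z x, X x])
      = (C.triv i).coord x 0
  simp only [map_sub, map_add, hβ.coord_cov hD i hx, ← hβ i x hx, map_zero]
  rw [← hG]
  abel

end TwoConnection

theorem mem_coboundaries2_of_subsingleton (D : CovariantDerivative (𝓡 (p + q)) F E)
    [Subsingleton (H2 D)] {b : Omega2 p q F E} (hb : dOmega2 D b = 0) : b ∈ coboundaries2 D := by
  have : (Submodule.Quotient.mk ⟨b, hb⟩ : H2 D) = 0 := Subsingleton.elim _ _
  exact (Submodule.Quotient.mk_eq_zero ((coboundaries2 D).submoduleOf (cocycles2 D))).1 this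

end FlatConnection

end HigherGauge

/-! ### The main theorem. -/

theorem mainTheorem4 (p q : ℕ)
    {M : Type*} [TopologicalSpace M] [ChartedSpace (EuclideanSpace ℝ (Fin (p + q))) M]
    [IsManifold (𝓡 (p + q)) ∞ M] [T2Space M] [SecondCountableTopology M]
    {F : Type*} [NormedAddCommGroup F] [NormedSpace ℝ F] [FiniteDimensional ℝ F]
    {E : M → Type*} [TopologicalSpace (TotalSpace F E)]
    [∀ x, AddCommGroup (E x)] [∀ x, Module ℝ (E x)] [∀ x, TopologicalSpace (E x)]
    [∀ x, IsTopologicalAddGroup (E x)] [∀ x, ContinuousSMul ℝ (E x)]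
    [FiberBundle F E] [VectorBundle ℝ F E] [ContMDiffVectorBundle ∞ F E (𝓡 (p + q))]
    (T : HigherGauge.FakeTangentBundle p q F E)
    {ι : Type*} (C : HigherGauge.TwoConnection T ι) (hC : C.IsFlat) :
    ∃ (D : CovariantDerivative (𝓡 (p + q)) F E)
      (β : ∀ x : M, TangentSpace (𝓡 (p + q)) x [⋀^Fin 2]→L[ℝ] E x),
      D.ContMDiffCovariantDerivative ∞ ∧ C.IsConnection D ∧
      HigherGauge.IsMetricPreserving T D ∧ HigherGauge.IsFlatConnection D ∧
      β ∈ HigherGauge.Omega2 p q F E ∧ C.IsTwoForm β ∧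
      (Subsingleton (HigherGauge.H2 D) →
        ∃ e : HigherGauge.Omega1 p q F E, ∀ (X Y : HigherGauge.VF p q M) (x : M),
          β x ![X x, Y x] = HigherGauge.dOmega1 D e X Y x) := by
  have hD := C.isConnection_conn
  have hβ := C.isTwoForm_twoForm
  refine ⟨C.conn, C.twoForm, hD.contMDiffCovariantDerivative, hD, hD.isMetricPreserving,
    hD.isFlatConnection hC.1, hβ.mem_Omega2, hβ, fun _ => ?_⟩
  -- Membership in `coboundaries2` is an equality of evaluations on all vector fields: that of d_D e
  -- with that of β.
  obtain ⟨e, he⟩ := HigherGauge.mem_coboundaries2_of_subsingleton C.conn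
    (hβ.dOmega2_eq_zero hD hC.2)
  exact ⟨e, fun X Y x => (congrFun (congrFun (congrFun he X) Y) x).symm⟩
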